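/- **Setting.** Let $D\subset\mathbb R^d$ be open, let $\kappa$ be measurable with $0<\kappa_{\min}\le\kappa\le\kappa_{\max}$ on $D$, let $f\in L^2(D)$, $G\in H^1(D)$, and let $u\in G+H^1_0(D)$ be the weak solution of $-\mathrm{div}(\kappa\nabla u)=f$ in $D$, $u=G$ on $\partial D$. Let $0<H\le 1$ and let a conforming partition of $D$ into convex polytopes of diameter at most $H$ (the coarse grid) be given, with nodes $x_i$, and let $\omega_i$ be the part in $D$ of the union of the closed elements that contain $x_i$. Let $\omega_i^+$ be open oversampled regions, $\omega_i\subseteq\omega_i^+\subseteq D$, such that each point lies in at most $C_0$ of them. Let $\chi_i\ge0$ be Lipschitz functions with $\sum_i\chi_i=1$ on $D$ and $\chi_i=0$ on $D\setminus\omega_i$, and let $0\le\chi_i^+\le1$ be Lipschitz functions with $\chi_i^+=0$ on $D\setminus\omega_i^+$, such that $$\chi_i^+\ge C_0^{-1}\ \text{ and }\ |\nabla\chi_i|^2\le C_0|\nabla\chi_i^+|^2\ \text{ on }\omega_i,\qquad (\chi_i^+)^2\le C_0H^2|\nabla\chi_i^+|^2\ \text{ on }\omega_i^+ .$$ Set $\tilde\kappa=\sum_i\kappa|\nabla\chi_i^+|^2$.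 **Offline space.** For each $i$ let finitely many snapshots $\psi^{i}_1,\dots,\psi^i_{M_i}\in H^1(\omega_i^+)$ be given that vanish on $\partial\omega_i^+\cap\partial D$, and consider in their span the spectral problem $A\Psi=\lambda S^+\Psi$ with $A_{mn}=\int_{\omega_i}\kappa\nabla\psi^i_m\cdot\nabla\psi^i_n$ and $S^+_{mn}=\int_{\omega_i^+}\tilde\kappa\,\psi^i_m\psi^i_n$. Let $\lambda^i_1\le\dots\le\lambda^i_{M_i}$ be its eigenvalues, with an $S^+$-orthonormal basis of eigenvectors and the corresponding eigenfunctions $\Psi^i_k$ on $\omega_i^+$. For each $i$ a number $0\le L_i\le M_i$ of eigenfunctions is selected, and $V_{\rm off}=\mathrm{span}\{\chi_i\Psi^i_k:\ k\le L_i\}$. Let $\Lambda_*$ be the smallest eigenvalue whose eigenvector is not included, $\Lambda_*=\min\{\lambda^i_k: k>L_i\}$. The GMsFEM solution is $u_H\in G+V_{\rm off}$ with $\int_D\kappa\nabla u_H\cdot\nabla v=\int_Dfv$ for all $v\in V_{\rm off}$. **Local residual.** Assume that $u-G$ agrees on every $\omega_i^+$ with an element of the span of the snapshots. Let $I_iu=G+P_i(u-G)$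 on $\omega_i^+$, where $P_i$ is the orthogonal projection in $L^2(\omega_i^+,\tilde\kappa)$ onto $\mathrm{span}\{\Psi^i_k:k\le L_i\}$, and let $g_i\in L^2(\omega_i^+)$ satisfy $-\mathrm{div}(\kappa\nabla(u-I_iu))=g_i$ weakly in $\omega_i^+$. **Theorem.** For every $d$ and $C_0$ there is $\Lambda_0\ge1$, depending only on $d$ and $C_0$, and for every $C_g$ there is a constant $C>0$, depending only on $d$, $C_0$ and $C_g$, such that in the above setting the following holds: if $\Lambda_*\ge\Lambda_0$ and $$\sum_i\int_{\omega_i^+}\kappa^{-1}g_i^2\le C_g,$$ then $$\int_D\kappa|\nabla(u-u_H)|^2\le C\left(\frac{H}{\Lambda_*}\int_D\kappa|\nabla u|^2+\frac{H}{\Lambda_*}\right).$$ In particular $\Lambda_0$ and $C$ depend neither on the contrast $\kappa_{\max}/\kappa_{\min}$ and the small scales of $\kappa$, nor on $H$, $\Lambda_*$, $D$, the grid, $f$, $G$ and the snapshots. -/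

import Mathlib

open MeasureTheory Filter Topology
open scoped InnerProductSpace Matrix

noncomputable section

namespace GMsFEM

/-- The ambient space `ℝ^d` with its Euclidean norm. -/
abbrev Pt (d : ℕ) : Type := EuclideanSpace ℝ (Fin d)

/-! ### Sobolev spaces -/

/-- Test functions: `φ ∈ C_c^∞(Ω)`. -/
structure IsTest {d : ℕ} (Ω : Set (Pt d)) (φ : Pt d → ℝ) : Prop where
  smooth : ContDiff ℝ (⊤ : ℕ∞) φ
  compact : HasCompactSupport φ
  subset : tsupport φ ⊆ Ω

/-- `u ∈ H¹(Ω)` with weak gradient `Du` (for open `Ω`; values outside `Ω` are irrelevant). -/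
structure IsH1 {d : ℕ} (Ω : Set (Pt d)) (u : Pt d → ℝ) (Du : Pt d → Pt d) : Prop where
  memLp : MemLp u 2 (volume.restrict Ω)
  memLp_grad : MemLp Du 2 (volume.restrict Ω)
  weak_grad : ∀ φ : Pt d → ℝ, IsTest Ω φ → ∀ y : Pt d,
    ∫ x in Ω, u x * ⟪gradient φ x, y⟫_ℝ = - ∫ x in Ω, ⟪Du x, y⟫_ℝ * φ x

/-- For open sets `ω ⊆ D`: `v` belongs to the closure in `H¹(ω)` of the restrictions to `ω` of
functions in `C_c^∞(D)`, and `Dv` is its weak gradient. These are the functions of `H¹(ω)` that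
vanish on `∂ω ∩ ∂D`; they are unconstrained on `∂ω ∩ D`. -/
structure IsH1Vanishing {d : ℕ} (D ω : Set (Pt d)) (v : Pt d → ℝ) (Dv : Pt d → Pt d) :
    Prop where
  memLp : MemLp v 2 (volume.restrict ω)
  memLp_grad : MemLp Dv 2 (volume.restrict ω)
  approx : ∃ φ : ℕ → Pt d → ℝ, (∀ n, IsTest D (φ n)) ∧
    Tendsto (fun n => eLpNorm (fun x => φ n x - v x) 2 (volume.restrict ω)) atTop (𝓝 0) ∧
    Tendsto (fun n => eLpNorm (fun x => gradient (φ n) x - Dv x) 2 (volume.restrict ω))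
      atTop (𝓝 0)

/-- `v ∈ H¹₀(Ω)` with weak gradient `Dv`. -/
def IsH1Zero {d : ℕ} (Ω : Set (Pt d)) (v : Pt d → ℝ) (Dv : Pt d → Pt d) : Prop :=
  IsH1Vanishing Ω Ω v Dv

/-! ### The elliptic problem -/

/-- The data of `-div(κ∇u) = f` in `D`, `u = G` on `∂D`, and its weak solution. The boundary
values are given by a function `G ∈ H¹(D)`. -/
structure EllipticProblem {d : ℕ} (D : Set (Pt d)) where
  κ : Pt d → ℝ
  κ_meas : Measurable κ
  κ_bounds : ∃ κmin κmax : ℝ, 0 < κmin ∧ ∀ x ∈ D, κmin ≤ κ x ∧ κ x ≤ κmax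
  f : Pt d → ℝ
  f_memLp : MemLp f 2 (volume.restrict D)
  G : Pt d → ℝ
  DG : Pt d → Pt d
  G_h1 : IsH1 D G DG
  u : Pt d → ℝ
  Du : Pt d → Pt d
  u_h1 : IsH1 D u Du
  u_boundary : IsH1Zero D (fun x => u x - G x) (fun x => Du x - DG x)
  u_weak : ∀ (v : Pt d → ℝ) (Dv : Pt d → Pt d), IsH1Zero D v Dv →
    ∫ x in D, κ x * ⟪Du x, Dv x⟫_ℝ = ∫ x in D, f x * v x

/-! ### Coarse grid, oversampled regions, partition of unity and cutoff functions -/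

/-- A conforming partition of `D` into `ne` convex polytopes of diameter at most `H`
with `nv` nodes. -/
structure CoarseGrid {d : ℕ} (D : Set (Pt d)) (H : ℝ) (nv ne : ℕ) where
  node : Fin nv → Pt d
  vert : Fin ne → Finset (Fin nv)
  node_injective : Function.Injective node
  node_used : ∀ i, ∃ j, i ∈ vert j
  interior_nonempty : ∀ j, (interior (convexHull ℝ (node '' (vert j)))).Nonempty
  extreme : ∀ j, ∀ i ∈ vert j, node i ∈ (convexHull ℝ (node '' (vert j))).extremePoints ℝ
  disjoint : ∀ j k, j ≠ k →
    Disjoint (interior (convexHull ℝ (node '' (vert j))))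
      (interior (convexHull ℝ (node '' (vert k))))
  conforming : ∀ j k, j ≠ k →
    convexHull ℝ (node '' (vert j)) ∩ convexHull ℝ (node '' (vert k)) =
      convexHull ℝ (node '' ((vert j : Set (Fin nv)) ∩ (vert k : Set (Fin nv))))
  cover : closure D = ⋃ j, convexHull ℝ (node '' (vert j))
  mesh_size : ∀ j, Metric.diam (convexHull ℝ (node '' (vert j))) ≤ H

/-- The `j`-th (closed) coarse element. -/
def CoarseGrid.elem {d : ℕ} {D : Set (Pt d)} {H : ℝ} {nv ne : ℕ} (T : CoarseGrid D H nv ne)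
    (j : Fin ne) : Set (Pt d) :=
  convexHull ℝ (T.node '' (T.vert j))

/-- The neighbourhood `ω_i` of the `i`-th node: the part in `D` of the union of the coarse elements
that contain the node. -/
def CoarseGrid.nbhd {d : ℕ} {D : Set (Pt d)} {H : ℝ} {nv ne : ℕ} (T : CoarseGrid D H nv ne)
    (i : Fin nv) : Set (Pt d) :=
  {x ∈ D | ∃ j, T.node i ∈ T.elem j ∧ x ∈ T.elem j}

/-- Oversampled regions `ω_i ⊆ ω_i⁺ ⊆ D`, a partition of unity `χ_i` subordinate to the `ω_i`, and
cutoff functions `χ_i⁺` that vanish off `ω_i⁺`, with structural constant `C₀`. -/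
structure Oversampling {d : ℕ} {D : Set (Pt d)} {H : ℝ} {nv ne : ℕ}
    (T : CoarseGrid D H nv ne) (C₀ : ℝ) where
  reg : Fin nv → Set (Pt d)
  reg_open : ∀ i, IsOpen (reg i)
  nbhd_subset : ∀ i, T.nbhd i ⊆ reg i
  reg_subset : ∀ i, reg i ⊆ D
  overlap : ∀ x ∈ D, ({i | x ∈ reg i}.ncard : ℝ) ≤ C₀
  χ : Fin nv → Pt d → ℝ
  χ_lipschitz : ∀ i, ∃ K, LipschitzWith K (χ i)
  χ_nonneg : ∀ i x, 0 ≤ χ i x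
  χ_sum : ∀ x ∈ D, ∑ i, χ i x = 1
  χ_support : ∀ i, ∀ x ∈ D, x ∉ T.nbhd i → χ i x = 0
  χp : Fin nv → Pt d → ℝ
  χp_lipschitz : ∀ i, ∃ K, LipschitzWith K (χp i)
  χp_nonneg : ∀ i x, 0 ≤ χp i x
  χp_le_one : ∀ i x, χp i x ≤ 1
  χp_support : ∀ i, ∀ x ∈ D, x ∉ reg i → χp i x = 0
  χp_lower : ∀ i, ∀ x ∈ T.nbhd i, 1 ≤ C₀ * χp i x
  /-- `|∇χ_i|² ≼ |∇χ_i⁺|²` -/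
  grad_le : ∀ i, ∀ᵐ x ∂(volume.restrict (T.nbhd i)),
    ‖fderiv ℝ (χ i) x‖ ^ 2 ≤ C₀ * ‖fderiv ℝ (χp i) x‖ ^ 2
  /-- `(|∇χ_i⁺|²)⁻¹ ≼ H²`, in a form that the bilinear functions satisfy at corners -/
  grad_lower : ∀ i, ∀ᵐ x ∂(volume.restrict (reg i)),
    χp i x ^ 2 ≤ C₀ * H ^ 2 * ‖fderiv ℝ (χp i) x‖ ^ 2

/-- The weight `κ̃ = ∑ᵢ κ |∇χ_i⁺|²`. -/
def massWeight {d : ℕ} {D : Set (Pt d)} {H : ℝ} {nv ne : ℕ} {T : CoarseGrid D H nv ne} {C₀ : ℝ}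
    (O : Oversampling T C₀) (κ : Pt d → ℝ) (x : Pt d) : ℝ :=
  ∑ i, κ x * ‖fderiv ℝ (O.χp i) x‖ ^ 2

/-! ### Local spectral problems and the offline space -/

/-- The matrix `∫_ω κ ∇ψ_m · ∇ψ_n`. -/
def stiffnessMatrix {d M : ℕ} (ω : Set (Pt d)) (κ : Pt d → ℝ) (Dψ : Fin M → Pt d → Pt d) :
    Matrix (Fin M) (Fin M) ℝ :=
  Matrix.of fun m n => ∫ x in ω, κ x * ⟪Dψ m x, Dψ n x⟫_ℝ

/-- The matrix `∫_ω w ψ_m ψ_n`. -/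
def massMatrix {d M : ℕ} (ω : Set (Pt d)) (w : Pt d → ℝ) (ψ : Fin M → Pt d → ℝ) :
    Matrix (Fin M) (Fin M) ℝ :=
  Matrix.of fun m n => ∫ x in ω, w x * (ψ m x * ψ n x)

/-- Snapshots `ψ_1, …, ψ_M` on `ω⁺` and the solution of the spectral problem `A Ψ = λ S⁺ Ψ` in
their span, with the stiffness matrix `A` over `ω` and the mass matrix `S⁺` over `ω⁺`:
eigenvalues in increasing order and an `S⁺`-orthonormal system of `M` eigenvectors; the first `L`
of them are selected. -/
structure LocalSpectral {d : ℕ} (D ω ωp : Set (Pt d)) (κ κt : Pt d → ℝ) where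
  M : ℕ
  ψ : Fin M → Pt d → ℝ
  Dψ : Fin M → Pt d → Pt d
  ψ_h1 : ∀ j, IsH1Vanishing D ωp (ψ j) (Dψ j)
  lam : Fin M → ℝ
  vec : Fin M → Fin M → ℝ
  lam_mono : Monotone lam
  eigen : ∀ k, stiffnessMatrix ω κ Dψ *ᵥ vec k = lam k • (massMatrix ωp κt ψ *ᵥ vec k)
  orthonormal : ∀ k l, vec k ⬝ᵥ (massMatrix ωp κt ψ *ᵥ vec l) = if k = l then 1 else 0
  L : ℕ
  L_le : L ≤ M

namespace LocalSpectral

variable {d : ℕ} {D ω ωp : Set (Pt d)} {κ κt : Pt d → ℝ}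

/-- The eigenfunction `∑_j Ψ_{kj} ψ_j`. -/
def mode (S : LocalSpectral D ω ωp κ κt) (k : Fin S.M) (x : Pt d) : ℝ :=
  ∑ j, S.vec k j * S.ψ j x

/-- The gradient of the eigenfunction `mode k`. -/
def modeGrad (S : LocalSpectral D ω ωp κ κt) (k : Fin S.M) (x : Pt d) : Pt d :=
  ∑ j, S.vec k j • S.Dψ j x

/-- The linear combination of the selected eigenfunctions with coefficients `c`. -/
def comb (S : LocalSpectral D ω ωp κ κt) (c : Fin S.M → ℝ) (x : Pt d) : ℝ :=
  ∑ k : Fin S.M, if (k : ℕ) < S.L then c k * S.mode k x else 0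

/-- The gradient of `comb c`. -/
def combGrad (S : LocalSpectral D ω ωp κ κt) (c : Fin S.M → ℝ) (x : Pt d) : Pt d :=
  ∑ k : Fin S.M, if (k : ℕ) < S.L then c k • S.modeGrad k x else 0

/-- The coefficients of the orthogonal projection of `w` in the `κ̃`-weighted `L²(ω⁺)`. -/
def coeff (S : LocalSpectral D ω ωp κ κt) (w : Pt d → ℝ) (k : Fin S.M) : ℝ :=
  ∫ x in ωp, κt x * (w x * S.mode k x)

end LocalSpectral

/-- The local spectral problems at all nodes. -/
abbrev SpectralFamily {d : ℕ} {D : Set (Pt d)} {H : ℝ} {nv ne : ℕ} {T : CoarseGrid D H nv ne}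
    {C₀ : ℝ} (O : Oversampling T C₀) (κ : Pt d → ℝ) : Type :=
  ∀ i : Fin nv, LocalSpectral D (T.nbhd i) (O.reg i) κ (massWeight O κ)

namespace SpectralFamily

variable {d : ℕ} {D : Set (Pt d)} {H : ℝ} {nv ne : ℕ} {T : CoarseGrid D H nv ne} {C₀ : ℝ}
  {O : Oversampling T C₀} {κ : Pt d → ℝ}

/-- The offline space, spanned by the products of `χ_i` with the selected eigenfunctions. -/
def IsOffline (S : SpectralFamily O κ) (v : Pt d → ℝ) : Prop :=
  ∃ c : (i : Fin nv) → Fin (S i).M → ℝ, v = fun x => ∑ i, O.χ i x * (S i).comb (c i) x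

/-- The eigenvalues whose eigenvectors are not included in the coarse space. -/
def excluded (S : SpectralFamily O κ) : Set ℝ :=
  {t | ∃ i, ∃ k : Fin (S i).M, (S i).L ≤ (k : ℕ) ∧ (S i).lam k = t}

end SpectralFamily

/-- `w` belongs on every `ω_i⁺` to the snapshot space. -/
def InSnapshots {d : ℕ} {D : Set (Pt d)} {H : ℝ} {nv ne : ℕ} {T : CoarseGrid D H nv ne} {C₀ : ℝ}
    {O : Oversampling T C₀} {κ : Pt d → ℝ} (S : SpectralFamily O κ) (w : Pt d → ℝ) : Prop :=
  ∀ i, ∃ a : Fin (S i).M → ℝ,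
    ∀ᵐ x ∂(volume.restrict (O.reg i)), w x = ∑ j, a j * (S i).ψ j x

/-- `g_i` is the local residual: `-div(κ∇(u - I_i u)) = g_i` weakly in `ω_i⁺`, where
`I_i u = G + (projection of u - G onto the selected eigenfunctions)`. -/
structure IsResidual {d : ℕ} {D : Set (Pt d)} {H : ℝ} {nv ne : ℕ} {T : CoarseGrid D H nv ne}
    {C₀ : ℝ} {O : Oversampling T C₀} (P : EllipticProblem D) (S : SpectralFamily O P.κ)
    (i : Fin nv) (g : Pt d → ℝ) : Prop where
  memLp : MemLp g 2 (volume.restrict (O.reg i))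
  weak : ∀ (v : Pt d → ℝ) (Dv : Pt d → Pt d), IsH1Zero (O.reg i) v Dv →
    ∫ x in O.reg i, P.κ x * ⟪P.Du x -
        (P.DG x + (S i).combGrad ((S i).coeff fun y => P.u y - P.G y) x), Dv x⟫_ℝ =
      ∫ x in O.reg i, g x * v x

/-- The GMsFEM (Galerkin) solution `u_H ∈ G + V_off`, with gradient `DuH`. -/
structure IsGalerkin {d : ℕ} {D : Set (Pt d)} {H : ℝ} {nv ne : ℕ} {T : CoarseGrid D H nv ne}
    {C₀ : ℝ} {O : Oversampling T C₀} (P : EllipticProblem D) (S : SpectralFamily O P.κ)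
    (uH : Pt d → ℝ) (DuH : Pt d → Pt d) : Prop where
  h1 : IsH1 D uH DuH
  offline : S.IsOffline fun x => uH x - P.G x
  galerkin : ∀ (v : Pt d → ℝ) (Dv : Pt d → Pt d), S.IsOffline v → IsH1Zero D v Dv →
    ∫ x in D, P.κ x * ⟪DuH x, Dv x⟫_ℝ = ∫ x in D, P.f x * v x

end GMsFEM

end

noncomputable section

namespace GMsFEM

/-! ### Convergence in `L²` and Lipschitz functions -/

/-! Write `e_i = u - I_i u`, which on `ω_i⁺` is `u - G` minus its spectral projection. Galerkin
orthogonality (`galerkin_error_le`) bounds the energy error of `u_H` by that of the interpolant `G +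
∑ χ_i P_i(u - G)`. Since the `χ_i` sum to one, the error of this interpolant is `∑ χ_i e_i`
(`interpolation_error_eq`), and finite overlap reduces its energy to a sum over the regions
(`galerkin_error_le_sum`).

On one region let `Y = ∫ κ (χ_i⁺)² |∇e_i|²` and `X = ∫ κ |∇χ_i⁺|² e_i²`, let `R = ∫ κ⁻¹ g_i²`, and
let `K = max C₀ 1`. Because `χ_i ≤ K χ_i⁺` and `|∇χ_i|² ≤ K |∇χ_i⁺|²` on `ω_i`, the energy of `χ_i
e_i` is at most `2K² Y + 2K X`. Two inequalities run in opposite directions: - the spectral problem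
gives `Λ X ≤ K² Y`: mass is taken over `ω_i⁺` with a weight dominating `κ |∇χ_i⁺|²`, energy only
over `ω_i`, where `χ_i⁺ ≥ 1/K` (`mul_cutoffMass_le`); - Caccioppoli's inequality, from testing the
residual equation with `(χ_i⁺)² e_i`, gives `Y ≤ s R + (K H²/s + 4) X` for every `s > 0`
(`cutoffEnergy_le`).

For `Λ ≥ 16 K²` and `s` proportional to `H²/Λ`, the `X` terms are absorbed into `Y`, so `Y` is at
most a constant times `(H²/Λ) R`. Summation gives an error of order `(H²/Λ) C_g`, which is stronger
than required: one factor `H ≤ 1` is given up, and the energy of `u` on the right-hand side is only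
added.

The Sobolev part has to show that products such as `χ_i Ψ` and `(χ_i⁺)² e_i` are admissible test
functions with the expected gradients, with no regularity of `∂D` or `∂ω_i⁺`. Cutoffs are truncated
to `(η - ε)₊`, which moves supports inside the open set; products with test functions are mollified;
then limits are taken in `H¹`. -/

theorem tendsto_eLpNorm_two_of_dominated {α E : Type*} [MeasurableSpace α] {μ : Measure α}
    [NormedAddCommGroup E] {F : ℕ → α → E} {f : α → E} {g : α → ℝ}
    (hF : ∀ n, AEStronglyMeasurable (F n) μ) (hf : AEStronglyMeasurable f μ)
    (hg : MemLp g 2 μ) (bound : ∀ᶠ n in atTop, ∀ᵐ x ∂μ, ‖F n x - f x‖ ≤ g x)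
    (lim : ∀ᵐ x ∂μ, Tendsto (fun n => F n x) atTop (𝓝 (f x))) :
    Tendsto (fun n => eLpNorm (fun x => F n x - f x) 2 μ) atTop (𝓝 0) := by
  have key : Tendsto (fun n => ∫⁻ x, ‖F n x - f x‖ₑ ^ (2 : ℝ) ∂μ) atTop (𝓝 (∫⁻ _, 0 ∂μ)) := by
    refine tendsto_lintegral_filter_of_dominated_convergence' (fun x => ‖g x‖ₑ ^ (2 : ℝ)) ?_ ?_ ?_ ?_
    · exact Eventually.of_forall fun n => ((hF n).sub hf).enorm.pow_const _
    · filter_upwards [bound] with n hn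
      filter_upwards [hn] with x hx
      gcongr
      rw [enorm_le_iff_norm_le]
      exact hx.trans (le_abs_self _)
    · have := hg.eLpNorm_lt_top
      rw [eLpNorm_lt_top_iff_lintegral_rpow_enorm_lt_top (by simp) (by simp)] at this
      simpa using this.ne
    · filter_upwards [lim] with x hx
      have h1 : Tendsto (fun n => F n x - f x) atTop (𝓝 0) := by
        simpa using hx.sub_const (f x)
      have h2 : Tendsto (fun n => ‖F n x - f x‖ₑ) atTop (𝓝 0) := by
        simpa using h1.enorm
      have h3 := ((ENNReal.continuous_rpow_const (y := (2 : ℝ))).tendsto 0).comp h2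
      rw [ENNReal.zero_rpow_of_pos (by norm_num)] at h3
      exact h3
  have h3 := ((ENNReal.continuous_rpow_const (y := (1 / 2 : ℝ))).tendsto 0).comp
    (by simpa using key)
  have h4 : (0 : ENNReal) ^ (1 / 2 : ℝ) = 0 := ENNReal.zero_rpow_of_pos (by norm_num)
  rw [h4] at h3
  refine h3.congr fun n => ?_
  simp [eLpNorm_eq_lintegral_rpow_enorm_toReal (two_ne_zero' ENNReal) ENNReal.ofNat_ne_top]

theorem norm_gradient {d : ℕ} (f : Pt d → ℝ) (x : Pt d) : ‖gradient f x‖ = ‖fderiv ℝ f x‖ := by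
  rw [gradient, LinearIsometryEquiv.norm_map]

theorem measurable_gradient {d : ℕ} (f : Pt d → ℝ) : Measurable (gradient f) :=
  (InnerProductSpace.toDual ℝ (Pt d)).symm.continuous.measurable.comp (measurable_fderiv ℝ f)

theorem norm_gradient_le {d : ℕ} {f : Pt d → ℝ} {K : NNReal} (hf : LipschitzWith K f)
    (x : Pt d) : ‖gradient f x‖ ≤ K := by
  rw [norm_gradient]; exact norm_fderiv_le_of_lipschitz ℝ hf

/-- No differentiability is needed, because the derivative is zero by convention where it does not
exist. Hence the gradient of a nonnegative cutoff vanishes at every zero of the cutoff, not only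
almost everywhere, and no null set at a boundary has to be treated. -/
theorem gradient_eq_zero_of_min {d : ℕ} {f : Pt d → ℝ} {x : Pt d} (hf : ∀ y, f x ≤ f y) :
    gradient f x = 0 := by
  have : IsLocalMin f x := Eventually.of_forall hf
  rw [gradient, this.fderiv_eq_zero, map_zero]

theorem gradient_mul {d : ℕ} {f g : Pt d → ℝ} {x : Pt d} (hf : DifferentiableAt ℝ f x)
    (hg : DifferentiableAt ℝ g x) :
    gradient (fun y => f y * g y) x = f x • gradient g x + g x • gradient f x := by
  simp only [gradient]
  rw [fderiv_fun_mul hf hg]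
  simp

theorem gradient_eq_zero_of_notMem_tsupport {d : ℕ} {f : Pt d → ℝ} {x : Pt d}
    (hx : x ∉ tsupport f) : gradient f x = 0 := by
  rw [gradient, image_eq_zero_of_notMem_tsupport (f := fderiv ℝ f)
    (fun h => hx (tsupport_fderiv_subset ℝ h)), map_zero]

/-- The gradient of a mollified Lipschitz function is the mollified gradient. -/
theorem gradient_convolution {d : ℕ} {f : Pt d → ℝ} {K : NNReal} (hf : LipschitzWith K f)
    (hc : HasCompactSupport f) (ρ : ContDiffBump (0 : Pt d)) (x : Pt d) :
    gradient (fun z => ∫ t, ρ.normed volume t * f (z - t)) x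
      = ∫ t, ρ.normed volume t • gradient f (x - t) := by
  obtain ⟨M, hM⟩ := hc.exists_bound_of_continuous hf.continuous
  have hρ : Integrable (ρ.normed volume) (volume : Measure (Pt d)) := ρ.integrable_normed
  -- Rademacher's theorem, transported by the reflection `t ↦ x - t`. The Lipschitz bound then
  -- dominates the difference quotients under the integral.
  have hd : ∀ᵐ t : Pt d, DifferentiableAt ℝ f (x - t) :=
    (quasiMeasurePreserving_sub_left_of_right_invariant volume x).ae hf.ae_differentiableAt
  have key := hasFDerivAt_integral_of_dominated_loc_of_lip (𝕜 := ℝ) (μ := (volume : Measure (Pt d)))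
    (F := fun z t => ρ.normed volume t * f (z - t))
    (F' := fun t => ρ.normed volume t • fderiv ℝ f (x - t)) (x₀ := x) (s := Set.univ)
    (bound := fun t => ρ.normed volume t * K) univ_mem ?_ ?_ ?_ ?_ ?_ ?_
  · have h1 := key.2.fderiv
    rw [gradient, h1, ← LinearIsometryEquiv.coe_toContinuousLinearEquiv,
      ← ContinuousLinearEquiv.integral_comp_comm]
    simp [gradient]
  · exact Eventually.of_forall fun z => (hρ.aestronglyMeasurable.mul
      ((hf.continuous.comp (continuous_const.sub continuous_id)).aestronglyMeasurable))
  · exact hρ.mul_bdd (c := M)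
      ((hf.continuous.comp (continuous_const.sub continuous_id)).aestronglyMeasurable)
      (Eventually.of_forall fun t => hM _)
  · exact hρ.aestronglyMeasurable.smul
      (((measurable_fderiv ℝ f).comp (measurable_const.sub measurable_id)).aestronglyMeasurable)
  · refine Eventually.of_forall fun t => LipschitzWith.lipschitzOnWith ?_
    refine LipschitzWith.of_dist_le_mul fun y z => ?_
    rw [Real.dist_eq, ← mul_sub, abs_mul, abs_of_nonneg (ρ.nonneg_normed t), Real.coe_nnabs,
      abs_of_nonneg (a := ρ.normed volume t * K) (mul_nonneg (ρ.nonneg_normed t) K.2), mul_assoc]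
    refine mul_le_mul_of_nonneg_left ?_ (ρ.nonneg_normed t)
    have := hf.dist_le_mul (y - t) (z - t)
    rwa [dist_sub_right, Real.dist_eq] at this
  · exact hρ.mul_const _
  · filter_upwards [hd] with t ht
    have h2 : HasFDerivAt (fun z => f (z - t)) (fderiv ℝ f (x - t)) x := 
      (hasFDerivAt_comp_sub t).2 ht.hasFDerivAt
    exact h2.const_mul _

/-- A mollification of a bounded function supported in `S` is bounded by the same constant and
supported near `S`. -/
theorem norm_mollify_le {d : ℕ} {E : Type*} [NormedAddCommGroup E] [NormedSpace ℝ E]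
    {h : Pt d → E} {B : ℝ} (hB : ∀ x, ‖h x‖ ≤ B) {S : Set (Pt d)} (hS : ∀ x, x ∉ S → h x = 0)
    (ρ : ContDiffBump (0 : Pt d)) {δ : ℝ} (hδ : ρ.rOut ≤ δ) (x : Pt d) :
    ‖∫ t, ρ.normed volume t • h (x - t)‖ ≤ (Metric.cthickening δ S).indicator (fun _ => B) x := by
  by_cases hx : x ∈ Metric.cthickening δ S
  · rw [Set.indicator_of_mem hx]
    calc ‖∫ t, ρ.normed volume t • h (x - t)‖ ≤ ∫ t, ρ.normed volume t * B := by
          refine norm_integral_le_of_norm_le (ρ.integrable_normed.mul_const _)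
            (Eventually.of_forall fun t => ?_)
          rw [norm_smul, Real.norm_eq_abs, abs_of_nonneg (ρ.nonneg_normed t)]
          exact mul_le_mul_of_nonneg_left (hB _) (ρ.nonneg_normed t)
      _ = B := by rw [integral_mul_const, ρ.integral_normed, one_mul]
  · rw [Set.indicator_of_notMem hx]
    have : ∀ t, ρ.normed volume t • h (x - t) = 0 := by
      intro t
      by_cases ht : ρ.normed volume t = 0
      · rw [ht, zero_smul]
      · have h1 : t ∈ Metric.ball (0 : Pt d) ρ.rOut := by
          rw [← ρ.support_normed_eq (μ := volume)]; exact ht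
        rw [hS _ fun hS' => hx ?_, smul_zero]
        refine Metric.mem_cthickening_of_dist_le x (x - t) δ S hS' ?_
        rw [dist_eq_norm, sub_sub_cancel]
        exact (mem_ball_zero_iff.1 h1).le.trans hδ
    simp [this]

theorem memLp_indicator_const {d : ℕ} {S : Set (Pt d)} (hS : IsCompact S) (B : ℝ)
    (ω : Set (Pt d)) : MemLp (S.indicator fun _ => B) 2 (volume.restrict ω) :=
  (MeasureTheory.memLp_indicator_const 2 hS.measurableSet B (Or.inr hS.measure_lt_top.ne)).restrict ω

/-- A Lipschitz function with compact support in an open set is the limit in `H¹` of test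
functions. -/
theorem isH1Zero_of_lipschitz {d : ℕ} {Ω : Set (Pt d)} (hΩ : IsOpen Ω) {f : Pt d → ℝ} {K : NNReal}
    (hf : LipschitzWith K f) (hc : HasCompactSupport f) (hs : tsupport f ⊆ Ω) :
    IsH1Zero Ω f (gradient f) := by
  obtain ⟨M, hM⟩ := hc.exists_bound_of_continuous hf.continuous
  have hf0 : ∀ x, x ∉ tsupport f → f x = 0 := fun x hx => image_eq_zero_of_notMem_tsupport hx
  have hg0 : ∀ x, x ∉ tsupport f → gradient f x = 0 :=
    fun x hx => gradient_eq_zero_of_notMem_tsupport hx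
  have bdd_memLp : ∀ {E : Type} [NormedAddCommGroup E] (h : Pt d → E) (B : ℝ),
      AEStronglyMeasurable h (volume.restrict Ω) → (∀ x, ‖h x‖ ≤ B) →
      (∀ x, x ∉ tsupport f → h x = 0) → MemLp h 2 (volume.restrict Ω) := by
    intro E _ h B hm hB h0
    refine (memLp_indicator_const (show IsCompact (tsupport f) from hc) B Ω).mono' hm
      (Eventually.of_forall fun x => ?_)
    by_cases hx : x ∈ tsupport f
    · simpa [hx] using hB x
    · simp [hx, h0 x hx]
  have hgm : ∀ ω : Set (Pt d), AEStronglyMeasurable (gradient f) (volume.restrict ω) :=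
    fun ω => (measurable_gradient f).aestronglyMeasurable
  have hfL := bdd_memLp f M hf.continuous.aestronglyMeasurable hM hf0
  have hgL := bdd_memLp (gradient f) K (hgm Ω) (norm_gradient_le hf) hg0
  obtain ⟨δ, δpos, hδ⟩ := (show IsCompact (tsupport f) from hc).exists_cthickening_subset_open hΩ hs
  have hcpt : IsCompact (Metric.cthickening δ (tsupport f)) :=
    (show IsCompact (tsupport f) from hc).cthickening
  let ρ : ℕ → ContDiffBump (0 : Pt d) := fun n =>
    ⟨δ / (n + 1) / 2, δ / (n + 1), by positivity, by
      have : 0 < δ / ((n : ℝ) + 1) := by positivity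
      linarith⟩
  have hρδ : ∀ n, (ρ n).rOut ≤ δ := fun n =>
    div_le_self δpos.le (by have : (0 : ℝ) ≤ n := n.cast_nonneg
                            linarith)
  have hρ0 : Tendsto (fun n => (ρ n).rOut) atTop (𝓝 0) := by
    have h1 : Tendsto (fun n : ℕ => (1 : ℝ) / (n + 1)) atTop (𝓝 0) :=
      tendsto_one_div_add_atTop_nhds_zero_nat
    have := h1.const_mul δ
    simpa [ρ, div_eq_mul_inv] using this
  -- Comparable inner and outer radii are what Lebesgue differentiation needs for almost everywhere
  -- convergence of the mollifications.
  have hρK : ∀ᶠ n in atTop, (ρ n).rOut ≤ 2 * (ρ n).rIn :=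
    Eventually.of_forall fun n => by simp [ρ]; linarith
  let φ : ℕ → Pt d → ℝ := fun n x => ∫ t, (ρ n).normed volume t * f (x - t)
  have hgrad : ∀ n x, gradient (φ n) x = ∫ t, (ρ n).normed volume t • gradient f (x - t) :=
    fun n x => gradient_convolution hf hc (ρ n) x
  have hbd : ∀ n x, ‖φ n x‖ ≤ (Metric.cthickening δ (tsupport f)).indicator (fun _ => M) x :=
    fun n x => norm_mollify_le hM hf0 (ρ n) (hρδ n) x
  have hbdg : ∀ n x, ‖gradient (φ n) x‖
      ≤ (Metric.cthickening δ (tsupport f)).indicator (fun _ => (K : ℝ)) x := fun n x => by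
    rw [hgrad]; exact norm_mollify_le (norm_gradient_le hf) hg0 (ρ n) (hρδ n) x
  have hfli : LocallyIntegrable f volume := hf.continuous.locallyIntegrable
  have hgli : LocallyIntegrable (gradient f) (volume : Measure (Pt d)) := by
    refine (locallyIntegrable_const (K : ℝ)).mono (measurable_gradient f).aestronglyMeasurable
      (Eventually.of_forall fun x => ?_)
    simpa using norm_gradient_le hf x
  have hsm : ∀ n, ContDiff ℝ (⊤ : ℕ∞) (φ n) := fun n =>
    (ρ n).hasCompactSupport_normed.contDiff_convolution_left (ContinuousLinearMap.lsmul ℝ ℝ)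
      (ρ n).contDiff_normed hfli
  have htest : ∀ n, IsTest Ω (φ n) := fun n => by
    have hsub : tsupport (φ n) ⊆ Metric.cthickening δ (tsupport f) := by
      refine closure_minimal (fun x hx => ?_) Metric.isClosed_cthickening
      by_contra hx'
      have := hbd n x
      rw [Set.indicator_of_notMem hx', norm_le_zero_iff] at this
      exact hx this
    exact ⟨hsm n, hcpt.of_isClosed_subset (isClosed_tsupport _) hsub, hsub.trans hδ⟩
  have dom : ∀ {E : Type} [NormedAddCommGroup E] (F : ℕ → Pt d → E) (h : Pt d → E) (B : ℝ),
      (∀ n x, ‖F n x‖ ≤ (Metric.cthickening δ (tsupport f)).indicator (fun _ => B) x) →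
      (∀ x, ‖h x‖ ≤ B) → (∀ x, x ∉ tsupport f → h x = 0) →
      ∀ n, ∀ᵐ x ∂volume.restrict Ω, ‖F n x - h x‖ ≤
        (Metric.cthickening δ (tsupport f)).indicator (fun _ => 2 * B) x := by
    intro E _ F h B hF hB h0 n
    refine Eventually.of_forall fun x => (norm_sub_le _ _).trans ?_
    have h1 := hF n x
    by_cases hx : x ∈ Metric.cthickening δ (tsupport f)
    · rw [Set.indicator_of_mem hx] at h1 ⊢
      linarith [hB x]
    · rw [Set.indicator_of_notMem hx] at h1 ⊢
      rw [h0 x fun h => hx (Metric.self_subset_cthickening _ h), norm_zero]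
      linarith
  refine ⟨hfL, hgL, φ, htest, ?_, ?_⟩
  · refine tendsto_eLpNorm_two_of_dominated (fun n => (hsm n).continuous.aestronglyMeasurable)
      hfL.1 (memLp_indicator_const hcpt (2 * M) Ω) (Eventually.of_forall (dom φ f M hbd hM hf0))
      (ae_restrict_of_ae ?_)
    exact ContDiffBump.ae_convolution_tendsto_right_of_locallyIntegrable hρ0 hρK hfli
  · refine tendsto_eLpNorm_two_of_dominated
      (fun n => (measurable_gradient (φ n)).aestronglyMeasurable)
      hgL.1 (memLp_indicator_const hcpt (2 * K) Ω)
      (Eventually.of_forall (dom (fun n => gradient (φ n)) (gradient f) K hbdg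
        (norm_gradient_le hf) hg0)) (ae_restrict_of_ae ?_)
    filter_upwards [ContDiffBump.ae_convolution_tendsto_right_of_locallyIntegrable hρ0 hρK hgli]
      with x hx
    simp only [hgrad]
    exact hx

/-! ### Operations on `H¹` functions vanishing on part of the boundary -/

theorem tendsto_eLpNorm_zero_of_le_mul {α E F : Type*} [MeasurableSpace α] {μ : Measure α}
    [NormedAddCommGroup E] [NormedAddCommGroup F] {A : ℕ → α → E} {B : ℕ → α → F} (c : ℝ)
    (h : ∀ n, ∀ᵐ x ∂μ, ‖A n x‖ ≤ c * ‖B n x‖)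
    (hB : Tendsto (fun n => eLpNorm (B n) 2 μ) atTop (𝓝 0)) :
    Tendsto (fun n => eLpNorm (A n) 2 μ) atTop (𝓝 0) := by
  have h1 : Tendsto (fun n => ENNReal.ofReal c * eLpNorm (B n) 2 μ) atTop (𝓝 0) := by
    simpa using ENNReal.Tendsto.const_mul hB (Or.inr ENNReal.ofReal_ne_top)
  exact tendsto_of_tendsto_of_tendsto_of_le_of_le tendsto_const_nhds h1 (fun _ => zero_le)
    fun n => eLpNorm_le_mul_eLpNorm_of_ae_le_mul (h n) 2

theorem tendsto_eLpNorm_zero_add {α E : Type*} [MeasurableSpace α] {μ : Measure α}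
    [NormedAddCommGroup E] {A B : ℕ → α → E} (hA : ∀ n, AEStronglyMeasurable (A n) μ)
    (hB : ∀ n, AEStronglyMeasurable (B n) μ)
    (tA : Tendsto (fun n => eLpNorm (A n) 2 μ) atTop (𝓝 0))
    (tB : Tendsto (fun n => eLpNorm (B n) 2 μ) atTop (𝓝 0)) :
    Tendsto (fun n => eLpNorm (fun x => A n x + B n x) 2 μ) atTop (𝓝 0) := by
  have h1 := tA.add tB
  rw [add_zero] at h1
  exact tendsto_of_tendsto_of_tendsto_of_le_of_le tendsto_const_nhds h1 (fun _ => zero_le)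
    fun n => eLpNorm_add_le (hA n) (hB n) (by norm_num)

theorem tendsto_integral_mul_of_tendsto_eLpNorm {α : Type*} [MeasurableSpace α] {μ : Measure α}
    {F : ℕ → α → ℝ} {f g : α → ℝ} (hF : ∀ n, MemLp (F n) 2 μ) (hf : MemLp f 2 μ)
    (hg : MemLp g 2 μ)
    (h : Tendsto (fun n => eLpNorm (fun x => F n x - f x) 2 μ) atTop (𝓝 0)) :
    Tendsto (fun n => ∫ x, F n x * g x ∂μ) atTop (𝓝 (∫ x, f x * g x ∂μ)) := by
  refine tendsto_integral_of_L1' _ (hf.1.mul hg.1)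
    (Eventually.of_forall fun n => (hF n).integrable_mul hg) ?_
  have h1 : Tendsto (fun n => eLpNorm (fun x => F n x - f x) 2 μ * eLpNorm g 2 μ)
      atTop (𝓝 0) := by
    simpa using ENNReal.Tendsto.mul_const h (Or.inr hg.2.ne)
  refine tendsto_of_tendsto_of_tendsto_of_le_of_le tendsto_const_nhds h1 (fun _ => zero_le)
    fun n => ?_
  have h2 := eLpNorm_smul_le_mul_eLpNorm (p := 2) (q := 2) (r := 1) hg.1 ((hF n).1.sub hf.1)
  refine le_trans (le_of_eq ?_) h2
  congr 1
  ext x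
  simp [sub_mul]

namespace IsTest

variable {d : ℕ} {Ω : Set (Pt d)} {φ ψ : Pt d → ℝ}

theorem differentiable (h : IsTest Ω φ) : Differentiable ℝ φ := h.smooth.differentiable (by simp)

theorem continuous_gradient (h : IsTest Ω φ) : Continuous (gradient φ) :=
  (InnerProductSpace.toDual ℝ (Pt d)).symm.continuous.comp (h.smooth.continuous_fderiv (by simp))

theorem hasCompactSupport_gradient (h : IsTest Ω φ) : HasCompactSupport (gradient φ) :=
  h.compact.mono' fun x hx => by
    by_contra h'
    exact hx (gradient_eq_zero_of_notMem_tsupport h')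

theorem memLp (h : IsTest Ω φ) (ω : Set (Pt d)) : MemLp φ 2 (volume.restrict ω) :=
  h.smooth.continuous.memLp_of_hasCompactSupport h.compact

theorem memLp_gradient (h : IsTest Ω φ) (ω : Set (Pt d)) :
    MemLp (gradient φ) 2 (volume.restrict ω) :=
  h.continuous_gradient.memLp_of_hasCompactSupport h.hasCompactSupport_gradient

theorem mono {Ω' : Set (Pt d)} (h : IsTest Ω φ) (hs : Ω ⊆ Ω') : IsTest Ω' φ :=
  ⟨h.smooth, h.compact, h.subset.trans hs⟩

theorem add (h : IsTest Ω φ) (h' : IsTest Ω ψ) : IsTest Ω fun x => φ x + ψ x :=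
  ⟨h.smooth.add h'.smooth, h.compact.add h'.compact,
    (tsupport_add _ _).trans (Set.union_subset h.subset h'.subset)⟩

theorem const_mul (h : IsTest Ω φ) (c : ℝ) : IsTest Ω fun x => c * φ x :=
  ⟨contDiff_const.mul h.smooth, h.compact.mul_left (f := fun _ => c),
    (tsupport_mul_subset_right (f := fun _ => c)).trans h.subset⟩

theorem gradient_add (h : IsTest Ω φ) (h' : IsTest Ω ψ) (x : Pt d) :
    gradient (fun x => φ x + ψ x) x = gradient φ x + gradient ψ x := by
  simp only [gradient]
  rw [fderiv_fun_add (h.differentiable x) (h'.differentiable x), map_add]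

theorem gradient_const_mul (h : IsTest Ω φ) (c : ℝ) (x : Pt d) :
    gradient (fun x => c * φ x) x = c • gradient φ x := by
  simp only [gradient]
  rw [fderiv_const_mul (h.differentiable x), map_smul]

end IsTest

namespace IsH1Vanishing

variable {d : ℕ} {D ω : Set (Pt d)} {u v : Pt d → ℝ} {Du Dv : Pt d → Pt d}

theorem of_isTest {φ : Pt d → ℝ} (h : IsTest D φ) : IsH1Vanishing D ω φ (gradient φ) :=
  ⟨h.memLp ω, h.memLp_gradient ω, fun _ => φ, fun _ => h, by simp, by simp⟩

theorem exists_test (h : IsH1Vanishing D ω v Dv) {ε : ENNReal} (hε : 0 < ε) :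
    ∃ φ, IsTest D φ ∧ eLpNorm (fun x => φ x - v x) 2 (volume.restrict ω) ≤ ε ∧
      eLpNorm (fun x => gradient φ x - Dv x) 2 (volume.restrict ω) ≤ ε := by
  obtain ⟨φ, hφ, t1, t2⟩ := h.approx
  obtain ⟨n, h1, h2⟩ := ((t1.eventually_le_const hε).and (t2.eventually_le_const hε)).exists
  exact ⟨φ n, hφ n, h1, h2⟩

/-- A closure is closed: choose for each `w n` a test function within `1/(n+1)` in `H¹`, and use the
triangle inequality. -/
theorem of_tendsto {w : ℕ → Pt d → ℝ} {Dw : ℕ → Pt d → Pt d}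
    (hw : ∀ n, IsH1Vanishing D ω (w n) (Dw n)) (hv : MemLp v 2 (volume.restrict ω))
    (hDv : MemLp Dv 2 (volume.restrict ω))
    (t1 : Tendsto (fun n => eLpNorm (fun x => w n x - v x) 2 (volume.restrict ω)) atTop (𝓝 0))
    (t2 : Tendsto (fun n => eLpNorm (fun x => Dw n x - Dv x) 2 (volume.restrict ω))
      atTop (𝓝 0)) : IsH1Vanishing D ω v Dv := by
  have hε : ∀ n : ℕ, (0 : ENNReal) < ((n : ENNReal) + 1)⁻¹ := fun n => by
    simp only [ENNReal.inv_pos]; finiteness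
  have hε0 : Tendsto (fun n : ℕ => ((n : ENNReal) + 1)⁻¹) atTop (𝓝 0) := by
    have := (ENNReal.tendsto_inv_nat_nhds_zero).comp (tendsto_add_atTop_nat 1)
    simpa [Function.comp_def] using this
  choose φ hφ h1 h2 using fun n => (hw n).exists_test (hε n)
  refine ⟨hv, hDv, φ, hφ, ?_, ?_⟩
  · have := tendsto_eLpNorm_zero_add (fun n => ((hφ n).memLp ω).1.sub (hw n).memLp.1)
      (fun n => (hw n).memLp.1.sub hv.1) (tendsto_of_tendsto_of_tendsto_of_le_of_le
        tendsto_const_nhds hε0 (fun _ => zero_le) h1) t1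
    simpa using this
  · have := tendsto_eLpNorm_zero_add (fun n => ((hφ n).memLp_gradient ω).1.sub (hw n).memLp_grad.1)
      (fun n => (hw n).memLp_grad.1.sub hDv.1) (tendsto_of_tendsto_of_tendsto_of_le_of_le
        tendsto_const_nhds hε0 (fun _ => zero_le) h2) t2
    simpa using this

theorem congr_ae (h : IsH1Vanishing D ω v Dv) (h1 : ∀ᵐ x ∂volume.restrict ω, v x = u x)
    (h2 : ∀ᵐ x ∂volume.restrict ω, Dv x = Du x) : IsH1Vanishing D ω u Du := by
  obtain ⟨φ, hφ, t1, t2⟩ := h.approx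
  refine ⟨h.memLp.ae_eq h1, h.memLp_grad.ae_eq h2, φ, hφ, ?_, ?_⟩
  · refine t1.congr fun n => eLpNorm_congr_ae ?_
    filter_upwards [h1] with x hx
    rw [hx]
  · refine t2.congr fun n => eLpNorm_congr_ae ?_
    filter_upwards [h2] with x hx
    rw [hx]

theorem mono_right {ω' : Set (Pt d)} (h : IsH1Vanishing D ω v Dv) (hs : ω' ⊆ ω) :
    IsH1Vanishing D ω' v Dv := by
  obtain ⟨φ, hφ, t1, t2⟩ := h.approx
  have hm := Measure.restrict_mono hs (le_refl (volume : Measure (Pt d)))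
  exact ⟨h.memLp.mono_measure hm, h.memLp_grad.mono_measure hm, φ, hφ,
    tendsto_of_tendsto_of_tendsto_of_le_of_le tendsto_const_nhds t1 (fun _ => zero_le)
      fun n => eLpNorm_mono_measure _ hm,
    tendsto_of_tendsto_of_tendsto_of_le_of_le tendsto_const_nhds t2 (fun _ => zero_le)
      fun n => eLpNorm_mono_measure _ hm⟩

theorem add (hu : IsH1Vanishing D ω u Du) (hv : IsH1Vanishing D ω v Dv) :
    IsH1Vanishing D ω (fun x => u x + v x) (fun x => Du x + Dv x) := by
  obtain ⟨φ, hφ, t1, t2⟩ := hu.approx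
  obtain ⟨ψ, hψ, s1, s2⟩ := hv.approx
  refine ⟨hu.memLp.add hv.memLp, hu.memLp_grad.add hv.memLp_grad, fun n x => φ n x + ψ n x,
    fun n => (hφ n).add (hψ n), ?_, ?_⟩
  · refine (tendsto_eLpNorm_zero_add (fun n => ((hφ n).memLp ω).1.sub hu.memLp.1)
      (fun n => ((hψ n).memLp ω).1.sub hv.memLp.1) t1 s1).congr fun n => ?_
    congr 1
    ext x
    simp only [Pi.sub_apply]
    ring
  · refine (tendsto_eLpNorm_zero_add (fun n => ((hφ n).memLp_gradient ω).1.sub hu.memLp_grad.1)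
      (fun n => ((hψ n).memLp_gradient ω).1.sub hv.memLp_grad.1) t2 s2).congr fun n => ?_
    congr 1
    ext1 x
    rw [(hφ n).gradient_add (hψ n)]
    simp only [Pi.sub_apply]
    abel

theorem const_mul (hv : IsH1Vanishing D ω v Dv) (c : ℝ) :
    IsH1Vanishing D ω (fun x => c * v x) (fun x => c • Dv x) := by
  obtain ⟨φ, hφ, t1, t2⟩ := hv.approx
  refine ⟨hv.memLp.const_mul c, hv.memLp_grad.const_smul c, fun n x => c * φ n x,
    fun n => (hφ n).const_mul c, tendsto_eLpNorm_zero_of_le_mul |c| (fun n => ?_) t1,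
    tendsto_eLpNorm_zero_of_le_mul |c| (fun n => ?_) t2⟩
  · exact Eventually.of_forall fun x => by rw [← mul_sub, norm_mul, Real.norm_eq_abs c]
  · exact Eventually.of_forall fun x => by
      rw [(hφ n).gradient_const_mul, ← smul_sub, norm_smul, Real.norm_eq_abs]

theorem sub (hu : IsH1Vanishing D ω u Du) (hv : IsH1Vanishing D ω v Dv) :
    IsH1Vanishing D ω (fun x => u x - v x) (fun x => Du x - Dv x) := by
  simpa [sub_eq_add_neg] using hu.add (hv.const_mul (-1))

theorem zero : IsH1Vanishing D ω (fun _ => 0) (fun _ => 0) := by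
  have h : IsTest D (fun _ => (0 : ℝ)) :=
    ⟨contDiff_const, HasCompactSupport.zero, by simp [tsupport]⟩
  have h2 := of_isTest (ω := ω) h
  have h3 : gradient (fun _ : Pt d => (0 : ℝ)) = fun _ => 0 := by
    ext1 x; simp [gradient]
  rwa [h3] at h2

theorem sum {ι : Type*} (s : Finset ι) {w : ι → Pt d → ℝ} {Dw : ι → Pt d → Pt d}
    (h : ∀ i ∈ s, IsH1Vanishing D ω (w i) (Dw i)) :
    IsH1Vanishing D ω (fun x => ∑ i ∈ s, w i x) (fun x => ∑ i ∈ s, Dw i x) := by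
  classical
  induction s using Finset.induction_on with
  | empty => simpa using zero
  | insert a s ha ih =>
    simp only [Finset.sum_insert ha]
    exact (h a (Finset.mem_insert_self _ _)).add
      (ih fun i hi => h i (Finset.mem_insert_of_mem hi))

theorem linearComb {ι : Type*} [Fintype ι] {w : ι → Pt d → ℝ} {Dw : ι → Pt d → Pt d}
    (h : ∀ i, IsH1Vanishing D ω (w i) (Dw i)) (c : ι → ℝ) :
    IsH1Vanishing D ω (fun x => ∑ i, c i * w i x) (fun x => ∑ i, c i • Dw i x) :=
  sum _ fun i _ => (h i).const_mul (c i)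

/-- Extension by zero. -/
theorem extend (hD : MeasurableSet D) (hωm : MeasurableSet ω) (h : IsH1Zero ω v Dv) (hω : ω ⊆ D)
    (h1 : ∀ x ∈ D, x ∉ ω → v x = 0) (h2 : ∀ x ∈ D, x ∉ ω → Dv x = 0) : IsH1Zero D v Dv := by
  obtain ⟨φ, hφ, t1, t2⟩ := h.approx
  have hφ0 : ∀ n x, x ∉ ω → φ n x = 0 := fun n x hx =>
    image_eq_zero_of_notMem_tsupport fun h => hx ((hφ n).subset h)
  have hg0 : ∀ n x, x ∉ ω → gradient (φ n) x = 0 := fun n x hx =>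
    gradient_eq_zero_of_notMem_tsupport fun h => hx ((hφ n).subset h)
  have ind : ∀ {E : Type} [NormedAddCommGroup E] (F : Pt d → E), (∀ x ∈ D, x ∉ ω → F x = 0) →
      ω.indicator F = D.indicator F := by
    intro E _ F hF
    ext1 x
    by_cases hx : x ∈ ω
    · simp [hx, hω hx]
    · by_cases hxD : x ∈ D
      · simp [hx, hxD, hF x hxD hx]
      · simp [hx, hxD]
  -- The same approximating sequence works on `D`: its members vanish off `ω`, as do `v` and `Dv` in
  -- `D`, so norms over `ω` and over `D` agree.
  refine ⟨?_, ?_, φ, fun n => (hφ n).mono hω, ?_, ?_⟩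
  · rw [← memLp_indicator_iff_restrict hD, ← ind v h1, memLp_indicator_iff_restrict hωm]
    exact h.memLp
  · rw [← memLp_indicator_iff_restrict hD, ← ind Dv h2, memLp_indicator_iff_restrict hωm]
    exact h.memLp_grad
  · refine t1.congr fun n => ?_
    rw [← eLpNorm_indicator_eq_eLpNorm_restrict hD, ← ind, eLpNorm_indicator_eq_eLpNorm_restrict hωm]
    intro x hx hx'
    rw [h1 x hx hx', hφ0 n x hx', sub_zero]
  · refine t2.congr fun n => ?_
    rw [← eLpNorm_indicator_eq_eLpNorm_restrict hD, ← ind, eLpNorm_indicator_eq_eLpNorm_restrict hωm]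
    intro x hx hx'
    rw [h2 x hx hx', hg0 n x hx', sub_zero]

/-- The gradient attached to a function that vanishes on part of the boundary is its weak
gradient. -/
theorem isH1 (h : IsH1Vanishing D ω v Dv) : IsH1 ω v Dv := by
  refine ⟨h.memLp, h.memLp_grad, fun ψ hψ y => ?_⟩
  obtain ⟨φ, hφ, t1, t2⟩ := h.approx
  have hψy : MemLp (fun x => ⟪gradient ψ x, y⟫_ℝ) 2 (volume.restrict ω) :=
    (hψ.memLp_gradient ω).inner_const y
  have s1 := tendsto_integral_mul_of_tendsto_eLpNorm (fun n => (hφ n).memLp ω) h.memLp hψy t1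
  have t2' : Tendsto (fun n => eLpNorm (fun x => ⟪gradient (φ n) x, y⟫_ℝ - ⟪Dv x, y⟫_ℝ) 2
      (volume.restrict ω)) atTop (𝓝 0) := by
    refine tendsto_eLpNorm_zero_of_le_mul ‖y‖ (fun n => Eventually.of_forall fun x => ?_) t2
    rw [← inner_sub_left, mul_comm]
    exact norm_inner_le_norm _ _
  have s2 := tendsto_integral_mul_of_tendsto_eLpNorm
    (fun n => ((hφ n).memLp_gradient ω).inner_const y) (h.memLp_grad.inner_const y)
    (hψ.memLp ω) t2'
  refine tendsto_nhds_unique s1 (s2.neg.congr fun n => ?_)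
  have hψ0 : ∀ x, x ∉ ω → ψ x = 0 := fun x hx =>
    image_eq_zero_of_notMem_tsupport fun h => hx (hψ.subset h)
  have hg0 : ∀ x, x ∉ ω → gradient ψ x = 0 := fun x hx =>
    gradient_eq_zero_of_notMem_tsupport fun h => hx (hψ.subset h)
  rw [setIntegral_eq_integral_of_forall_compl_eq_zero (fun x hx => by simp [hψ0 x hx]),
    setIntegral_eq_integral_of_forall_compl_eq_zero (fun x hx => by simp [hg0 x hx])]
  have c1 := (hφ n).smooth.continuous
  have c2 := (hφ n).continuous_gradient
  have c3 := hψ.smooth.continuous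
  have c4 := hψ.continuous_gradient
  have ibp := integral_mul_fderiv_eq_neg_fderiv_mul_of_integrable (μ := (volume : Measure (Pt d)))
    (f := φ n) (g := ψ) (v := y) ?_ ?_ ?_ (fun x _ => (hφ n).differentiable x)
    (fun x _ => hψ.differentiable x)
  · simp only [← inner_gradient_left] at ibp
    exact ibp.symm
  · simp only [← inner_gradient_left]
    exact ((c2.inner continuous_const).mul c3).integrable_of_hasCompactSupport hψ.compact.mul_left
  · simp only [← inner_gradient_left]
    exact (c1.mul (c4.inner continuous_const)).integrable_of_hasCompactSupport
      (hφ n).compact.mul_right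
  · exact (c1.mul c3).integrable_of_hasCompactSupport hψ.compact.mul_left

end IsH1Vanishing

/-! ### Uniqueness of weak gradients. -/

namespace IsH1

variable {d : ℕ} {Ω : Set (Pt d)} {u v : Pt d → ℝ} {Du Dv : Pt d → Pt d}

theorem sub (hu : IsH1 Ω u Du) (hv : IsH1 Ω v Dv) :
    IsH1 Ω (fun x => u x - v x) (fun x => Du x - Dv x) := by
  refine ⟨hu.memLp.sub hv.memLp, hu.memLp_grad.sub hv.memLp_grad, fun φ hφ y => ?_⟩
  have m1 := (hφ.memLp_gradient Ω).inner_const (𝕜 := ℝ) y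
  have m2 := hφ.memLp Ω
  have e1 := integral_sub (hu.memLp.integrable_mul m1) (hv.memLp.integrable_mul m1)
  have e2 := integral_sub ((hu.memLp_grad.inner_const (𝕜 := ℝ) y).integrable_mul m2)
    ((hv.memLp_grad.inner_const (𝕜 := ℝ) y).integrable_mul m2)
  simp only [Pi.mul_apply] at e1 e2
  simp only [sub_mul, inner_sub_left]
  rw [e1, e2, hu.weak_grad φ hφ, hv.weak_grad φ hφ]
  ring

/-- Weak gradients are unique. -/
theorem grad_ae_eq (hΩ : IsOpen Ω) (hu : IsH1 Ω u Du) (hv : IsH1 Ω v Dv)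
    (h : ∀ᵐ x ∂volume.restrict Ω, u x = v x) : ∀ᵐ x ∂volume.restrict Ω, Du x = Dv x := by
  have hd := hu.sub hv
  have hloc : LocallyIntegrableOn (fun x => Du x - Dv x) Ω volume :=
    locallyIntegrableOn_of_locallyIntegrable_restrict
      (hd.memLp_grad.locallyIntegrable (by norm_num))
  -- The fundamental lemma of the calculus of variations for the difference of the gradients, tested
  -- against each constant vector `y`.
  have key := hΩ.ae_eq_zero_of_integral_contDiff_smul_eq_zero hloc fun φ h1 h2 h3 => ?_
  · rw [ae_restrict_iff' hΩ.measurableSet]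
    filter_upwards [key] with x hx hxΩ
    exact sub_eq_zero.1 (hx hxΩ)
  · have ht : IsTest Ω φ := ⟨h1, h2, h3⟩
    have hφ0 : ∀ x, x ∉ Ω → φ x = 0 := fun x hx =>
      image_eq_zero_of_notMem_tsupport fun h => hx (h3 h)
    rw [← setIntegral_eq_integral_of_forall_compl_eq_zero
      (s := Ω) (fun x hx => by simp [hφ0 x hx])]
    have hint : Integrable (fun x => φ x • (Du x - Dv x)) (volume.restrict Ω) :=
      memLp_one_iff_integrable.1 (hd.memLp_grad.smul (p := 2) (q := 2) (r := 1) (ht.memLp Ω))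
    refine ext_inner_right ℝ fun y => ?_
    rw [inner_zero_left, real_inner_comm, ← integral_inner hint]
    have := hd.weak_grad φ ht y
    rw [integral_eq_zero_of_ae (by
      filter_upwards [h] with x hx
      simp [hx])] at this
    rw [← neg_eq_zero, this]
    congr 1
    refine integral_congr_ae (Eventually.of_forall fun x => ?_)
    simp only
    rw [inner_smul_right, real_inner_comm, mul_comm]

end IsH1

/-! ### Multiplication by Lipschitz functions -/

/-- The cutoffs `χ_i` are bounded by one only on `D`, so `η` is controlled only where `φ` is
nonzero. This suffices: the product is expanded at whichever of the two points has `φ ≠ 0`. -/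
theorem lipschitzWith_mul {d : ℕ} {η φ : Pt d → ℝ} {K L : NNReal} {M : ℝ} (hη : LipschitzWith K η)
    (hφ : LipschitzWith L φ) (hM : ∀ x, |φ x| ≤ M) (h1 : ∀ x, φ x ≠ 0 → |η x| ≤ 1) :
    ∃ C, LipschitzWith C fun x => η x * φ x := by
  have hM0 : 0 ≤ M := (abs_nonneg _).trans (hM 0)
  have main : ∀ x y, φ x ≠ 0 → |η x * φ x - η y * φ y| ≤ (L + M * K) * dist x y := by
    intro x y hx
    have e : η x * φ x - η y * φ y = η x * (φ x - φ y) + φ y * (η x - η y) := by ring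
    have l1 := hφ.dist_le_mul x y
    have l2 := hη.dist_le_mul x y
    rw [Real.dist_eq] at l1 l2
    calc |η x * φ x - η y * φ y| ≤ |η x| * |φ x - φ y| + |φ y| * |η x - η y| := by
          rw [e, ← abs_mul, ← abs_mul]; exact abs_add_le _ _
      _ ≤ 1 * (L * dist x y) + M * (K * dist x y) := by
          gcongr
          · exact h1 x hx
          · exact hM y
      _ = _ := by ring
  refine ⟨⟨L + M * K, by positivity⟩, LipschitzWith.of_dist_le_mul fun x y => ?_⟩
  rw [Real.dist_eq]
  by_cases hx : φ x = 0
  · by_cases hy : φ y = 0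
    · simp only [hx, hy, mul_zero, sub_zero, abs_zero]
      exact mul_nonneg (NNReal.coe_nonneg _) dist_nonneg
    · rw [abs_sub_comm, dist_comm]
      exact main y x hy
  · exact main x y hx

/-- The truncation `(η - ε)₊`. -/
def truncate {d : ℕ} (ε : ℝ) (η : Pt d → ℝ) (x : Pt d) : ℝ := max (η x - ε) 0

section truncate

variable {d : ℕ} {η : Pt d → ℝ} {ε : ℝ} {x : Pt d}

theorem truncate_nonneg : 0 ≤ truncate ε η x := le_max_right _ _

theorem truncate_eq_zero (h : η x ≤ ε) : truncate ε η x = 0 := max_eq_right (by linarith)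

theorem truncate_le (hη : 0 ≤ η x) (hε : 0 ≤ ε) : truncate ε η x ≤ η x :=
  max_le (by linarith) hη

theorem abs_truncate_sub_le (hη : 0 ≤ η x) (hε : 0 ≤ ε) : |truncate ε η x - η x| ≤ ε := by
  unfold truncate
  rw [abs_le]
  refine ⟨by linarith [le_max_left (η x - ε) 0], ?_⟩
  have : max (η x - ε) 0 ≤ η x := max_le (by linarith) hη
  linarith

theorem lipschitzWith_truncate {K : NNReal} (h : LipschitzWith K η) :
    LipschitzWith K (truncate ε η) := by
  have h1 : LipschitzWith K fun x => η x - ε := by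
    refine LipschitzWith.of_dist_le_mul fun x y => ?_
    rw [dist_sub_right]
    exact h.dist_le_mul x y
  exact h1.max_const 0

theorem gradient_truncate_of_le (h : η x ≤ ε) : gradient (truncate ε η) x = 0 :=
  gradient_eq_zero_of_min fun y => by rw [truncate_eq_zero h]; exact truncate_nonneg

theorem gradient_truncate_of_lt (hc : Continuous η) (h : ε < η x) :
    gradient (truncate ε η) x = gradient η x := by
  have h1 : truncate ε η =ᶠ[𝓝 x] fun y => η y - ε := by
    filter_upwards [hc.continuousAt.eventually (lt_mem_nhds h)] with y hy
    exact max_eq_left (by linarith)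
  rw [h1.gradient_eq, gradient, gradient, fderiv_sub_const]

end truncate

/-- A Lipschitz function `η ≥ 0` that vanishes in `D` off `ω` maps test functions on `D` to
`H¹₀(ω)`. -/
theorem IsTest.mul_lipschitz {d : ℕ} {D ω : Set (Pt d)} (hω : IsOpen ω) {η φ : Pt d → ℝ}
    {K : NNReal} (hη : LipschitzWith K η) (h0 : ∀ x, 0 ≤ η x) (h1 : ∀ x ∈ D, η x ≤ 1)
    (hz : ∀ x ∈ D, x ∉ ω → η x = 0) (hφ : IsTest D φ) :
    IsH1Zero ω (fun x => η x * φ x) (fun x => η x • gradient φ x + φ x • gradient η x) := by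
  have hφD : ∀ x, φ x ≠ 0 → x ∈ D := fun x hx => hφ.subset (subset_tsupport φ hx)
  obtain ⟨L, hL⟩ := ContDiff.lipschitzWith_of_hasCompactSupport hφ.compact hφ.smooth (by simp)
  obtain ⟨M, hM⟩ := hφ.compact.exists_bound_of_continuous hφ.smooth.continuous
  let ε : ℕ → ℝ := fun n => 1 / ((n : ℝ) + 1)
  have hε0 : ∀ n, 0 < ε n := fun n => by positivity
  have hε1 : ∀ n, ε n ≤ 1 := fun n => by
    rw [div_le_one (by positivity)]
    have : (0 : ℝ) ≤ n := n.cast_nonneg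
    linarith
  have hεt : Tendsto ε atTop (𝓝 0) := tendsto_one_div_add_atTop_nhds_zero_nat
  have hφd : ∀ x, φ x = 0 ∨ η x ≤ 1 := fun x => by
    by_cases h : φ x = 0
    · exact Or.inl h
    · exact Or.inr (h1 x (hφD x h))
  have hgd : ∀ x, gradient φ x = 0 ∨ η x ≤ 1 := fun x => by
    by_cases h : x ∈ tsupport φ
    · exact Or.inr (h1 x (hφ.subset h))
    · exact Or.inl (gradient_eq_zero_of_notMem_tsupport h)
  have hmη : AEStronglyMeasurable η (volume.restrict ω) := hη.continuous.aestronglyMeasurable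
  have hmg : AEStronglyMeasurable (gradient η) (volume.restrict ω) :=
    (measurable_gradient η).aestronglyMeasurable
  have hprod : ∀ n, IsH1Zero ω (fun x => truncate (ε n) η x * φ x)
      (fun x => truncate (ε n) η x • gradient φ x + φ x • gradient (truncate (ε n) η) x) := by
    intro n
    have hl := lipschitzWith_truncate (ε := ε n) hη
    obtain ⟨C, hC⟩ := lipschitzWith_mul hl hL hM fun x hx => by
      rw [abs_of_nonneg truncate_nonneg]
      exact (truncate_le (h0 x) (hε0 n).le).trans (h1 x (hφD x hx))
    -- The purpose of the truncation: the support lies in the closed set where `η ≥ ε`, while `η =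
    -- 0` in `D` off `ω`. So it stays inside the open set `ω`, whatever its boundary.
    have hsupp : tsupport (fun x => truncate (ε n) η x * φ x) ⊆ ω := by
      have hsub : tsupport (fun x => truncate (ε n) η x * φ x) ⊆ {x | ε n ≤ η x} ∩ tsupport φ := by
        refine closure_minimal (fun x hx => ⟨?_, subset_tsupport φ fun h => hx (by simp [h])⟩)
          ((isClosed_le continuous_const hη.continuous).inter (isClosed_tsupport φ))
        by_contra h
        exact hx (by simp [truncate_eq_zero (not_le.1 h).le])
      intro x hx
      by_contra h
      have := hz x (hφ.subset (hsub hx).2) h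
      have h3 : ε n ≤ η x := (hsub hx).1
      linarith [hε0 n]
    refine IsH1Vanishing.congr_ae (isH1Zero_of_lipschitz hω hC hφ.compact.mul_left hsupp)
      (Eventually.of_forall fun _ => rfl) (ae_restrict_of_ae ?_)
    filter_upwards [hl.ae_differentiableAt (μ := volume)] with x hx
    exact gradient_mul hx (hφ.differentiable x)
  have hL1 : MemLp (fun x => η x * φ x) 2 (volume.restrict ω) :=
    (hφ.memLp ω).of_le (hmη.mul (hφ.memLp ω).1) (Eventually.of_forall fun x => by
      rw [norm_mul, Real.norm_of_nonneg (h0 x)]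
      rcases hφd x with h | h
      · simp [h]
      · exact mul_le_of_le_one_left (norm_nonneg _) h)
  have hL2 : MemLp (fun x => η x • gradient φ x) 2 (volume.restrict ω) :=
    (hφ.memLp_gradient ω).of_le (hmη.smul (hφ.memLp_gradient ω).1) (Eventually.of_forall fun x => by
      rw [norm_smul, Real.norm_of_nonneg (h0 x)]
      rcases hgd x with h | h
      · simp [h]
      · exact mul_le_of_le_one_left (norm_nonneg _) h)
  have hL3 : MemLp (fun x => φ x • gradient η x) 2 (volume.restrict ω) :=
    (hφ.memLp ω).of_le_mul (c := K) ((hφ.memLp ω).1.smul hmg) (Eventually.of_forall fun x => by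
      rw [norm_smul, mul_comm]
      exact mul_le_mul_of_nonneg_right (norm_gradient_le hη x) (norm_nonneg _))
  refine IsH1Vanishing.of_tendsto hprod hL1 (hL2.add hL3) ?_ ?_
  · refine tendsto_eLpNorm_two_of_dominated (fun n => (hprod n).memLp.1) hL1.1
      (hφ.memLp ω).norm (Eventually.of_forall fun n => Eventually.of_forall fun x => ?_)
      (Eventually.of_forall fun x => ?_)
    · rw [← sub_mul, norm_mul, Real.norm_eq_abs]
      exact mul_le_of_le_one_left (norm_nonneg _)
        ((abs_truncate_sub_le (h0 x) (hε0 n).le).trans (hε1 n))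
    · refine Tendsto.mul_const _ ?_
      rw [tendsto_iff_dist_tendsto_zero]
      exact squeeze_zero (fun _ => dist_nonneg)
        (fun n => abs_truncate_sub_le (h0 x) (hε0 n).le) hεt
  · refine tendsto_eLpNorm_two_of_dominated (fun n => (hprod n).memLp_grad.1) (hL2.add hL3).1
      ((hφ.memLp_gradient ω).norm.add hL3.norm)
      (Eventually.of_forall fun n => Eventually.of_forall fun x => ?_)
      (Eventually.of_forall fun x => ?_)
    · simp only [Pi.add_apply]
      rw [add_sub_add_comm, ← sub_smul, ← smul_sub]
      refine (norm_add_le _ _).trans (add_le_add ?_ ?_)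
      · rw [norm_smul, Real.norm_eq_abs]
        exact mul_le_of_le_one_left (norm_nonneg _)
          ((abs_truncate_sub_le (h0 x) (hε0 n).le).trans (hε1 n))
      · rw [norm_smul, norm_smul]
        refine mul_le_mul_of_nonneg_left ?_ (norm_nonneg _)
        rcases le_or_gt (η x) (ε n) with h | h
        · rw [gradient_truncate_of_le h, zero_sub, norm_neg]
        · rw [gradient_truncate_of_lt hη.continuous h, sub_self, norm_zero]
          exact norm_nonneg _
    · have tη : Tendsto (fun n => truncate (ε n) η x) atTop (𝓝 (η x)) := by
        rw [tendsto_iff_dist_tendsto_zero]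
        exact squeeze_zero (fun _ => dist_nonneg)
          (fun n => abs_truncate_sub_le (h0 x) (hε0 n).le) hεt
      -- The gradients converge at every point: where `η = 0` all of them vanish, and where `η > 0`
      -- the sequence is eventually constant.
      have tg : Tendsto (fun n => gradient (truncate (ε n) η) x) atTop (𝓝 (gradient η x)) := by
        rcases (h0 x).eq_or_lt with h | h
        · have e : gradient η x = 0 := gradient_eq_zero_of_min fun y => h ▸ h0 y
          rw [e]
          refine tendsto_const_nhds.congr fun n => ?_
          rw [gradient_truncate_of_le]
          rw [← h]; exact (hε0 n).le
        · refine tendsto_const_nhds.congr' ?_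
          filter_upwards [hεt.eventually_lt_const h] with n hn
          rw [gradient_truncate_of_lt hη.continuous hn]
      exact (tη.smul_const _).add (tg.const_smul _)

/-- A Lipschitz function `η ≥ 0` that vanishes in `D` off `ω` maps functions on `ω` vanishing on
`∂ω ∩ ∂D` to `H¹₀(ω)`. -/
theorem IsH1Vanishing.mul_lipschitz {d : ℕ} {D ω : Set (Pt d)} (hω : IsOpen ω) (hωD : ω ⊆ D)
    {η v : Pt d → ℝ} {Dv : Pt d → Pt d}
    {K : NNReal} (hη : LipschitzWith K η) (h0 : ∀ x, 0 ≤ η x) (h1 : ∀ x ∈ D, η x ≤ 1)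
    (hz : ∀ x ∈ D, x ∉ ω → η x = 0) (hv : IsH1Vanishing D ω v Dv) :
    IsH1Zero ω (fun x => η x * v x) (fun x => η x • Dv x + v x • gradient η x) := by
  obtain ⟨φ, hφ, t1, t2⟩ := hv.approx
  have hmη : AEStronglyMeasurable η (volume.restrict ω) := hη.continuous.aestronglyMeasurable
  have hmg : AEStronglyMeasurable (gradient η) (volume.restrict ω) :=
    (measurable_gradient η).aestronglyMeasurable
  have hη1 : ∀ᵐ x ∂volume.restrict ω, ‖η x‖ ≤ 1 := by
    filter_upwards [ae_restrict_mem hω.measurableSet] with x hx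
    rw [Real.norm_of_nonneg (h0 x)]
    exact h1 x (hωD hx)
  have hL1 : MemLp (fun x => η x * v x) 2 (volume.restrict ω) :=
    hv.memLp.of_le (hmη.mul hv.memLp.1) (by
      filter_upwards [hη1] with x hx
      rw [norm_mul]
      exact mul_le_of_le_one_left (norm_nonneg _) hx)
  have hL2 : MemLp (fun x => η x • Dv x) 2 (volume.restrict ω) :=
    hv.memLp_grad.of_le (hmη.smul hv.memLp_grad.1) (by
      filter_upwards [hη1] with x hx
      rw [norm_smul]
      exact mul_le_of_le_one_left (norm_nonneg _) hx)
  have hL3 : MemLp (fun x => v x • gradient η x) 2 (volume.restrict ω) :=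
    hv.memLp.of_le_mul (c := K) (hv.memLp.1.smul hmg) (Eventually.of_forall fun x => by
      rw [norm_smul, mul_comm]
      exact mul_le_mul_of_nonneg_right (norm_gradient_le hη x) (norm_nonneg _))
  refine IsH1Vanishing.of_tendsto (fun n => (hφ n).mul_lipschitz hω hη h0 h1 hz) hL1
    (hL2.add hL3) ?_ ?_
  · refine tendsto_eLpNorm_zero_of_le_mul 1 (fun n => ?_) t1
    filter_upwards [hη1] with x hx
    rw [← mul_sub, norm_mul]
    exact mul_le_mul_of_nonneg_right hx (norm_nonneg _)
  · have mg := fun n => (((hφ n).memLp_gradient ω).1.sub hv.memLp_grad.1)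
    have mf := fun n => (((hφ n).memLp ω).1.sub hv.memLp.1)
    have := tendsto_eLpNorm_zero_add (A := fun n x => η x • (gradient (φ n) x - Dv x))
      (B := fun n x => (φ n x - v x) • gradient η x) (fun n => hmη.smul (mg n))
      (fun n => (mf n).smul hmg)
      (tendsto_eLpNorm_zero_of_le_mul 1 (fun n => ?_) t2)
      (tendsto_eLpNorm_zero_of_le_mul K (fun n => Eventually.of_forall fun x => ?_) t1)
    · refine this.congr fun n => ?_
      congr 1
      ext1 x
      rw [smul_sub, sub_smul]
      abel
    · filter_upwards [hη1] with x hx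
      rw [norm_smul]
      exact mul_le_mul_of_nonneg_right hx (norm_nonneg _)
    · rw [norm_smul, mul_comm]
      exact mul_le_mul_of_nonneg_right (norm_gradient_le hη x) (norm_nonneg _)

/-! ### Energy estimates -/

theorem integrable_weight_mul {α : Type*} [MeasurableSpace α] {μ : Measure α} {c f g : α → ℝ}
    {B : ℝ} (hc : AEStronglyMeasurable c μ) (hB : ∀ᵐ x ∂μ, ‖c x‖ ≤ B) (hf : MemLp f 2 μ)
    (hg : MemLp g 2 μ) : Integrable (fun x => c x * (f x * g x)) μ :=
  (hf.integrable_mul hg).bdd_mul hc hB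

theorem integrable_weight_inner {α : Type*} [MeasurableSpace α] {μ : Measure α} {d : ℕ}
    {c : α → ℝ} {F G : α → Pt d} {B : ℝ} (hc : AEStronglyMeasurable c μ)
    (hB : ∀ᵐ x ∂μ, ‖c x‖ ≤ B) (hF : MemLp F 2 μ) (hG : MemLp G 2 μ) :
    Integrable (fun x => c x * ⟪F x, G x⟫_ℝ) μ := by
  refine Integrable.bdd_mul ?_ hc hB
  refine (hF.norm.integrable_mul hG.norm).mono' (hF.1.inner hG.1)
    (Eventually.of_forall fun x => ?_)
  exact norm_inner_le_norm _ _

theorem integrable_weight_norm_sq {α : Type*} [MeasurableSpace α] {μ : Measure α} {d : ℕ}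
    {c : α → ℝ} {F : α → Pt d} {B : ℝ} (hc : AEStronglyMeasurable c μ)
    (hB : ∀ᵐ x ∂μ, ‖c x‖ ≤ B) (hF : MemLp F 2 μ) :
    Integrable (fun x => c x * ‖F x‖ ^ 2) μ := by
  simpa only [real_inner_self_eq_norm_sq] using integrable_weight_inner hc hB hF hF

theorem integrable_weight_sq {α : Type*} [MeasurableSpace α] {μ : Measure α}
    {c f : α → ℝ} {B : ℝ} (hc : AEStronglyMeasurable c μ)
    (hB : ∀ᵐ x ∂μ, ‖c x‖ ≤ B) (hf : MemLp f 2 μ) :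
    Integrable (fun x => c x * f x ^ 2) μ := by
  simpa only [pow_two] using integrable_weight_mul hc hB hf hf

/-- Expanding the inner product gives `2kη²|De|²` plus a cross term. Young's inequality spends half
of the square on the cross term, leaving `4k|Dη|²e²`. In the residual term, `η⁴ ≤ η² ≤ c|Dη|²`
converts `η⁴e²` to the same weight, with free parameter `s`. -/
theorem caccioppoli_pointwise {d : ℕ} {k η e g c s : ℝ} {De Dη : Pt d} (hk : 0 < k) (h0 : 0 ≤ η)
    (h1 : η ≤ 1) (hs : 0 < s) (hη : η ^ 2 ≤ c * ‖Dη‖ ^ 2) :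
    k * η ^ 2 * ‖De‖ ^ 2 ≤
      2 * (k * ⟪De, (η * η) • De + e • (2 * η) • Dη⟫_ℝ) - 2 * (g * (η * η * e)) +
        (s * (k⁻¹ * g ^ 2) + (c / s + 4) * (k * ‖Dη‖ ^ 2 * e ^ 2)) := by
  rw [inner_add_right, inner_smul_right, inner_smul_right, inner_smul_right,
    real_inner_self_eq_norm_sq]
  have cs : |⟪De, Dη⟫_ℝ| ≤ ‖De‖ * ‖Dη‖ := abs_real_inner_le_norm _ _
  have a1 : -(η ^ 2 * ‖De‖ ^ 2 + 4 * (e ^ 2 * ‖Dη‖ ^ 2)) ≤ 4 * (e * (η * ⟪De, Dη⟫_ℝ)) := by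
    have h2 : |e * η * ⟪De, Dη⟫_ℝ| ≤ |e * η| * (‖De‖ * ‖Dη‖) := by
      rw [abs_mul]; exact mul_le_mul_of_nonneg_left cs (abs_nonneg _)
    have h3 := (abs_le.1 h2).1
    have h4 : |e * η| * (‖De‖ * ‖Dη‖) * 4 ≤ η ^ 2 * ‖De‖ ^ 2 + 4 * (e ^ 2 * ‖Dη‖ ^ 2) := by
      rw [abs_mul, abs_of_nonneg h0, ← sq_abs e]
      nlinarith [sq_nonneg (η * ‖De‖ - 2 * (|e| * ‖Dη‖))]
    nlinarith
  have a2 : 2 * (g * (η * η * e)) ≤ s * (k⁻¹ * g ^ 2) + c / s * (k * ‖Dη‖ ^ 2 * e ^ 2) := by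
    have h2 : 2 * (g * (η * η * e)) ≤ s * (k⁻¹ * g ^ 2) + s⁻¹ * k * (η * η * e) ^ 2 := by
      have : s * (k⁻¹ * g ^ 2) + s⁻¹ * k * (η * η * e) ^ 2 - 2 * (g * (η * η * e))
          = s⁻¹ * k⁻¹ * (s * g - k * (η * η * e)) ^ 2 := by
        field_simp
        ring
      have h5 : 0 ≤ s⁻¹ * k⁻¹ * (s * g - k * (η * η * e)) ^ 2 := by positivity
      linarith
    have h3 : (η * η * e) ^ 2 ≤ c * ‖Dη‖ ^ 2 * e ^ 2 := by
      have h4 : η ^ 2 * η ^ 2 ≤ 1 * η ^ 2 :=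
        mul_le_mul_of_nonneg_right (by nlinarith) (sq_nonneg η)
      calc (η * η * e) ^ 2 = η ^ 2 * η ^ 2 * e ^ 2 := by ring
        _ ≤ c * ‖Dη‖ ^ 2 * e ^ 2 := mul_le_mul_of_nonneg_right (by linarith) (sq_nonneg e)
    calc 2 * (g * (η * η * e)) ≤ _ := h2
      _ ≤ s * (k⁻¹ * g ^ 2) + s⁻¹ * k * (c * ‖Dη‖ ^ 2 * e ^ 2) := by gcongr
      _ = _ := by ring
  nlinarith [mul_le_mul_of_nonneg_left a1 hk.le]

/-- Caccioppoli inequality with cutoff function `η`. -/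
theorem caccioppoli {α : Type*} [MeasurableSpace α] {μ : Measure α} {d : ℕ} {κ η e g : α → ℝ}
    {De Dη : α → Pt d} {c s : ℝ} (hs : 0 < s) (hκ : ∀ᵐ x ∂μ, 0 < κ x) (h0 : ∀ x, 0 ≤ η x)
    (h1 : ∀ x, η x ≤ 1) (hη : ∀ᵐ x ∂μ, η x ^ 2 ≤ c * ‖Dη x‖ ^ 2)
    (i1 : Integrable (fun x => κ x * η x ^ 2 * ‖De x‖ ^ 2) μ)
    (i2 : Integrable (fun x => (κ x)⁻¹ * g x ^ 2) μ)
    (i3 : Integrable (fun x => κ x * ‖Dη x‖ ^ 2 * e x ^ 2) μ)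
    (i4 : Integrable (fun x => κ x * ⟪De x, (η x * η x) • De x + e x • (2 * η x) • Dη x⟫_ℝ) μ)
    (i5 : Integrable (fun x => g x * (η x * η x * e x)) μ)
    (weak : ∫ x, κ x * ⟪De x, (η x * η x) • De x + e x • (2 * η x) • Dη x⟫_ℝ ∂μ =
      ∫ x, g x * (η x * η x * e x) ∂μ) :
    ∫ x, κ x * η x ^ 2 * ‖De x‖ ^ 2 ∂μ ≤
      s * ∫ x, (κ x)⁻¹ * g x ^ 2 ∂μ + (c / s + 4) * ∫ x, κ x * ‖Dη x‖ ^ 2 * e x ^ 2 ∂μ := by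
  have hle := integral_mono_ae i1
    (((i4.const_mul 2).sub (i5.const_mul 2)).add ((i2.const_mul s).add (i3.const_mul (c / s + 4))))
    (by
      filter_upwards [hκ, hη] with x hx hx'
      exact caccioppoli_pointwise hx (h0 x) (h1 x) hs hx')
  refine hle.trans (le_of_eq ?_)
  simp only [Pi.add_apply, Pi.sub_apply]
  have e1 := integral_add ((i4.const_mul 2).sub (i5.const_mul 2))
    ((i2.const_mul s).add (i3.const_mul (c / s + 4)))
  have e2 := integral_sub (i4.const_mul 2) (i5.const_mul 2)
  have e3 := integral_add (i2.const_mul s) (i3.const_mul (c / s + 4))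
  simp only [Pi.add_apply, Pi.sub_apply] at e1 e2 e3
  rw [e1, e2, e3, integral_const_mul, integral_const_mul, integral_const_mul, integral_const_mul,
    weak]
  ring

/-- The approximation property of Galerkin solutions. -/
theorem energy_le_of_orthogonal {α : Type*} [MeasurableSpace α] {μ : Measure α} {d : ℕ}
    {κ : α → ℝ} {E F : α → Pt d} (hκ : ∀ᵐ x ∂μ, 0 ≤ κ x)
    (i1 : Integrable (fun x => κ x * ‖E x‖ ^ 2) μ) (i2 : Integrable (fun x => κ x * ‖F x‖ ^ 2) μ)
    (i3 : Integrable (fun x => κ x * ⟪E x, E x - F x⟫_ℝ) μ)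
    (orth : ∫ x, κ x * ⟪E x, E x - F x⟫_ℝ ∂μ = 0) :
    ∫ x, κ x * ‖E x‖ ^ 2 ∂μ ≤ ∫ x, κ x * ‖F x‖ ^ 2 ∂μ := by
  have h : ∫ x, κ x * ‖E x‖ ^ 2 - 2 * (κ x * ⟪E x, E x - F x⟫_ℝ) ∂μ
      ≤ - ∫ x, κ x * ‖E x‖ ^ 2 ∂μ + ∫ x, κ x * ‖F x‖ ^ 2 ∂μ
        + ∫ x, κ x * ‖E x‖ ^ 2 ∂μ := by
    rw [neg_add_cancel_comm]
    refine integral_mono_ae (i1.sub (i3.const_mul 2)) i2 ?_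
    filter_upwards [hκ] with x hx
    -- The cross term integrates to zero by orthogonality, and the last square is dropped.
    have h1 : ‖F x‖ ^ 2 = ‖E x‖ ^ 2 - 2 * ⟪E x, E x - F x⟫_ℝ + ‖E x - F x‖ ^ 2 := by
      have := norm_sub_sq_real (E x) (E x - F x)
      rwa [sub_sub_cancel] at this
    have h2 : 0 ≤ κ x * ‖E x - F x‖ ^ 2 := by positivity
    rw [h1]
    linarith
  have e := integral_sub i1 (i3.const_mul 2)
  rw [integral_const_mul, orth] at e
  linarith

/-! ### The spectral problem -/

section Spectral

variable {M : ℕ} {A B : Matrix (Fin M) (Fin M) ℝ} {vec : Fin M → Fin M → ℝ} {lam : Fin M → ℝ}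

theorem sum_smul_dotProduct_mulVec (t : Fin M → ℝ) {μ : Fin M → ℝ}
    (h : ∀ k l, vec k ⬝ᵥ (A *ᵥ vec l) = if k = l then μ k else 0) :
    (∑ k, t k • vec k) ⬝ᵥ (A *ᵥ ∑ k, t k • vec k) = ∑ k, μ k * t k ^ 2 := by
  rw [Matrix.mulVec_sum, sum_dotProduct]
  refine Finset.sum_congr rfl fun k _ => ?_
  rw [dotProduct_sum]
  simp only [Matrix.mulVec_smul, smul_dotProduct, dotProduct_smul, h, smul_eq_mul]
  simp only [mul_ite, mul_zero, Finset.sum_ite_eq, Finset.mem_univ, if_true]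
  ring

/-- With the vectors as rows of `V`, orthonormality reads `V (B Vᵀ) = 1`. A one-sided inverse of a
square matrix is two-sided, so `M` orthonormal vectors already form a basis. -/
theorem eq_sum_of_orthonormal
    (orth : ∀ k l, vec k ⬝ᵥ (B *ᵥ vec l) = if k = l then 1 else 0) (a : Fin M → ℝ) : a = ∑ k, (a ⬝ᵥ (B *ᵥ vec k)) • vec k := by
  let V : Matrix (Fin M) (Fin M) ℝ := Matrix.of vec
  have h1 : V * (B * Vᵀ) = 1 := by
    ext k l
    rw [Matrix.one_apply, ← orth k l]
    rfl
  have h2 : (B * Vᵀ) * V = 1 := mul_eq_one_comm.1 h1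
  have h3 : a ᵥ* ((B * Vᵀ) * V) = a := by rw [h2, Matrix.vecMul_one]
  rw [← Matrix.vecMul_vecMul] at h3
  nth_rewrite 1 [← h3]
  rw [Matrix.vecMul_eq_sum]
  rfl

end Spectral

theorem integral_mul_sum_sum {α ι : Type*} [Fintype ι] [MeasurableSpace α] {μ : Measure α}
    {F : ι → ι → α → ℝ} (hF : ∀ m n, Integrable (F m n) μ) (a b : ι → ℝ) :
    ∫ x, ∑ m, ∑ n, a m * b n * F m n x ∂μ = a ⬝ᵥ (Matrix.of (fun m n => ∫ x, F m n x ∂μ) *ᵥ b) := by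
  rw [integral_finsetSum _ fun m _ => integrable_finsetSum _ fun n _ => (hF m n).const_mul _]
  refine Finset.sum_congr rfl fun m _ => ?_
  rw [integral_finsetSum _ fun n _ => (hF m n).const_mul _, Matrix.mulVec, dotProduct,
    Finset.mul_sum]
  refine Finset.sum_congr rfl fun n _ => ?_
  rw [integral_const_mul, Matrix.of_apply]
  ring

namespace LocalSpectral

variable {d : ℕ} {D ω ωp : Set (Pt d)} {κ κt : Pt d → ℝ}

theorem mode_isH1Vanishing (S : LocalSpectral D ω ωp κ κt) (k : Fin S.M) :
    IsH1Vanishing D ωp (S.mode k) (S.modeGrad k) :=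
  IsH1Vanishing.linearComb S.ψ_h1 (S.vec k)

theorem comb_eq (S : LocalSpectral D ω ωp κ κt) (c : Fin S.M → ℝ) :
    S.comb c = fun x => ∑ k : Fin S.M, (if (k : ℕ) < S.L then c k else 0) * S.mode k x := by
  ext x
  exact Finset.sum_congr rfl fun k _ => by split_ifs <;> simp

theorem combGrad_eq (S : LocalSpectral D ω ωp κ κt) (c : Fin S.M → ℝ) :
    S.combGrad c = fun x => ∑ k : Fin S.M, (if (k : ℕ) < S.L then c k else 0) • S.modeGrad k x := by
  ext1 x
  exact Finset.sum_congr rfl fun k _ => by split_ifs <;> simp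

theorem comb_isH1Vanishing (S : LocalSpectral D ω ωp κ κt) (c : Fin S.M → ℝ) :
    IsH1Vanishing D ωp (S.comb c) (S.combGrad c) := by
  rw [comb_eq, combGrad_eq]
  exact IsH1Vanishing.linearComb S.mode_isH1Vanishing _

/-- The error of the spectral projection in the weighted `L²` norm is controlled by its energy and
the first excluded eigenvalue. -/
theorem projection_error (S : LocalSpectral D ω ωp κ κt)
    (hm : ∀ m n, Integrable (fun x => κt x * (S.ψ m x * S.ψ n x)) (volume.restrict ωp))
    (ha : ∀ m n, Integrable (fun x => κ x * ⟪S.Dψ m x, S.Dψ n x⟫_ℝ) (volume.restrict ω))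
    {w : Pt d → ℝ} {a : Fin S.M → ℝ}
    (hw : ∀ᵐ x ∂volume.restrict ωp, w x = ∑ j, a j * S.ψ j x) {Λ : ℝ}
    (hΛ : ∀ k : Fin S.M, S.L ≤ (k : ℕ) → Λ ≤ S.lam k) :
    ∃ b : Fin S.M → ℝ,
      (∀ x, ∑ j, a j * S.ψ j x - S.comb (S.coeff w) x = ∑ j, b j * S.ψ j x) ∧
      (∀ x, ∑ j, a j • S.Dψ j x - S.combGrad (S.coeff w) x = ∑ j, b j • S.Dψ j x) ∧
      Λ * ∫ x in ωp, κt x * (∑ j, b j * S.ψ j x) ^ 2 ≤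
        ∫ x in ω, κ x * ‖∑ j, b j • S.Dψ j x‖ ^ 2 := by
  set B := massMatrix ωp κt S.ψ with hB
  set A := stiffnessMatrix ω κ S.Dψ with hA
  set c := S.coeff w with hc
  -- The integral coefficients of the projection agree with the algebraic coefficients in the
  -- eigenvector basis, because `w` is a combination of snapshots.
  have hck : ∀ k, a ⬝ᵥ (B *ᵥ S.vec k) = c k := by
    intro k
    rw [hB, massMatrix, ← integral_mul_sum_sum hm, hc, coeff]
    refine integral_congr_ae ?_
    filter_upwards [hw] with x hx
    rw [hx, mode, Finset.sum_mul_sum, Finset.mul_sum]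
    refine Finset.sum_congr rfl fun m _ => ?_
    rw [Finset.mul_sum]
    exact Finset.sum_congr rfl fun n _ => by ring
  have hexp : a = ∑ k, c k • S.vec k := by
    conv_lhs => rw [eq_sum_of_orthonormal S.orthonormal a]
    simp only [← hck]
    rfl
  let t : Fin S.M → ℝ := fun k => if (k : ℕ) < S.L then 0 else c k
  let b : Fin S.M → ℝ := ∑ k, t k • S.vec k
  have hab : ∀ j, a j = (∑ k : Fin S.M, (if (k : ℕ) < S.L then c k else 0) * S.vec k j) + b j := by
    intro j
    rw [hexp]
    simp only [b, Finset.sum_apply, Pi.smul_apply, smul_eq_mul]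
    rw [← Finset.sum_add_distrib]
    refine Finset.sum_congr rfl fun k _ => ?_
    simp only [t]
    split_ifs <;> simp
  refine ⟨b, fun x => ?_, fun x => ?_, ?_⟩
  · rw [comb_eq, sub_eq_iff_eq_add']
    simp only [hab, mode, add_mul, Finset.sum_add_distrib, Finset.sum_mul, Finset.mul_sum]
    rw [Finset.sum_comm]
    simp only [mul_assoc]
  · rw [combGrad_eq, sub_eq_iff_eq_add']
    simp only [hab, modeGrad, add_smul, Finset.sum_add_distrib, Finset.sum_smul, Finset.smul_sum]
    rw [Finset.sum_comm]
    simp only [mul_smul]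
  · have q1 : ∫ x in ωp, κt x * (∑ j, b j * S.ψ j x) ^ 2 = b ⬝ᵥ (B *ᵥ b) := by
      rw [hB, massMatrix, ← integral_mul_sum_sum hm]
      congr 1
      ext x
      rw [pow_two, Finset.sum_mul_sum, Finset.mul_sum]
      refine Finset.sum_congr rfl fun m _ => ?_
      rw [Finset.mul_sum]
      exact Finset.sum_congr rfl fun n _ => by ring
    have q2 : ∫ x in ω, κ x * ‖∑ j, b j • S.Dψ j x‖ ^ 2 = b ⬝ᵥ (A *ᵥ b) := by
      rw [hA, stiffnessMatrix, ← integral_mul_sum_sum ha]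
      congr 1
      ext x
      rw [← real_inner_self_eq_norm_sq, sum_inner, Finset.mul_sum]
      refine Finset.sum_congr rfl fun m _ => ?_
      rw [inner_sum, Finset.mul_sum]
      refine Finset.sum_congr rfl fun n _ => ?_
      rw [inner_smul_left, inner_smul_right]
      simp only [conj_trivial]
      ring
    -- The eigenvalue equation makes the basis orthogonal for the stiffness form too. Both forms are
    -- then diagonal on the excluded part `b`, and the estimate holds coefficient by coefficient.
    have oA : ∀ k l, S.vec k ⬝ᵥ (A *ᵥ S.vec l) = if k = l then S.lam k else 0 := by
      intro k l
      rw [S.eigen l, dotProduct_smul, S.orthonormal k l]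
      split_ifs with h <;> simp [h]
    rw [q1, q2, sum_smul_dotProduct_mulVec t oA,
      sum_smul_dotProduct_mulVec (μ := fun _ => 1) t S.orthonormal, Finset.mul_sum]
    refine Finset.sum_le_sum fun k _ => ?_
    simp only [t]
    split_ifs with h
    · simp
    · rw [one_mul]
      exact mul_le_mul_of_nonneg_right (hΛ k (not_lt.1 h)) (sq_nonneg _)

end LocalSpectral

/-! ### The coarse grid and the cutoff functions -/

theorem CoarseGrid.measurableSet_nbhd {d : ℕ} {D : Set (Pt d)} {H : ℝ} {nv ne : ℕ}
    (T : CoarseGrid D H nv ne) (hD : MeasurableSet D) (i : Fin nv) : MeasurableSet (T.nbhd i) := by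
  have h : T.nbhd i = D ∩ ⋃ j ∈ {j | T.node i ∈ T.elem j}, T.elem j := by
    ext x
    simp [CoarseGrid.nbhd]
  rw [h]
  refine hD.inter (MeasurableSet.biUnion (Set.to_countable _) fun j _ => ?_)
  exact (((T.vert j).finite_toSet.image T.node).isCompact_convexHull (𝕜 := ℝ)).measurableSet

theorem EllipticProblem.exists_bounds {d : ℕ} {D : Set (Pt d)} (P : EllipticProblem D) :
    ∃ B : ℝ, ∀ x ∈ D, 0 < P.κ x ∧ ‖P.κ x‖ ≤ B ∧ ‖(P.κ x)⁻¹‖ ≤ B := by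
  obtain ⟨a, b, ha, hb⟩ := P.κ_bounds
  refine ⟨max b a⁻¹, fun x hx => ?_⟩
  have h0 : 0 < P.κ x := ha.trans_le (hb x hx).1
  refine ⟨h0, ?_, ?_⟩
  · rw [Real.norm_of_nonneg h0.le]
    exact (hb x hx).2.trans (le_max_left _ _)
  · rw [Real.norm_of_nonneg (inv_nonneg.2 h0.le)]
    exact (inv_anti₀ ha (hb x hx).1).trans (le_max_right _ _)

namespace Oversampling

variable {d : ℕ} {D : Set (Pt d)} {H : ℝ} {nv ne : ℕ} {T : CoarseGrid D H nv ne} {C₀ : ℝ}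

theorem χ_le_one (O : Oversampling T C₀) (i : Fin nv) : ∀ x ∈ D, O.χ i x ≤ 1 := fun x hx => by
  rw [← O.χ_sum x hx]
  exact Finset.single_le_sum (f := fun i => O.χ i x) (fun j _ => O.χ_nonneg j x)
    (Finset.mem_univ i)

theorem gradient_χ_eq_zero (O : Oversampling T C₀) {i : Fin nv} {x : Pt d} (h : O.χ i x = 0) :
    gradient (O.χ i) x = 0 :=
  gradient_eq_zero_of_min fun y => h ▸ O.χ_nonneg i y

theorem sum_gradient_χ (O : Oversampling T C₀) (hD : IsOpen D) :
    ∀ᵐ x ∂volume.restrict D, ∑ i, gradient (O.χ i) x = 0 := by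
  have hd : ∀ᵐ x ∂volume.restrict D, ∀ i, DifferentiableAt ℝ (O.χ i) x := by
    refine ae_restrict_of_ae (ae_all_iff.2 fun i => ?_)
    obtain ⟨K, hK⟩ := O.χ_lipschitz i
    exact hK.ae_differentiableAt
  filter_upwards [hd, ae_restrict_mem hD.measurableSet] with x hx hxD
  have h1 : (fun y => ∑ i, O.χ i y) =ᶠ[𝓝 x] fun _ => 1 := by
    filter_upwards [hD.mem_nhds hxD] with y hy using O.χ_sum y hy
  have h2 := h1.fderiv_eq (𝕜 := ℝ)
  rw [fderiv_fun_sum fun i _ => hx i, fderiv_fun_const] at h2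
  simp only [gradient]
  rw [← map_sum, h2]
  simp

theorem exists_massWeight_bound (O : Oversampling T C₀) {κ : Pt d → ℝ} {B : ℝ}
    (hB : ∀ x ∈ D, ‖κ x‖ ≤ B) : ∃ B', ∀ x ∈ D, ‖massWeight O κ x‖ ≤ B' := by
  choose K hK using O.χp_lipschitz
  refine ⟨∑ i, B * (K i : ℝ) ^ 2, fun x hx => (norm_sum_le _ _).trans ?_⟩
  refine Finset.sum_le_sum fun i _ => ?_
  rw [norm_mul, norm_pow, norm_norm]
  have h1 : ‖fderiv ℝ (O.χp i) x‖ ≤ K i := norm_fderiv_le_of_lipschitz ℝ (hK i)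
  have := (norm_nonneg _).trans (hB x hx)
  have h2 := hB x hx
  gcongr

theorem measurable_massWeight (O : Oversampling T C₀) {κ : Pt d → ℝ} (hκ : Measurable κ) :
    Measurable (massWeight O κ) := by
  refine Finset.measurable_fun_sum _ fun i _ => ?_
  exact hκ.mul ((measurable_fderiv ℝ (O.χp i)).norm.pow_const 2)

theorem le_massWeight (O : Oversampling T C₀) {κ : Pt d → ℝ} {x : Pt d} (hκ : 0 ≤ κ x)
    (i : Fin nv) : κ x * ‖gradient (O.χp i) x‖ ^ 2 ≤ massWeight O κ x := by
  rw [norm_gradient]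
  exact Finset.single_le_sum (f := fun i => κ x * ‖fderiv ℝ (O.χp i) x‖ ^ 2)
    (fun j _ => by positivity) (Finset.mem_univ i)

/-- The product lies in `H¹₀(ω_i⁺)` and extends by zero, so the values of `v` off `ω_i⁺` do not
matter. This makes both the offline functions and the `χ_i e_i` admissible on `D`. -/
theorem χ_mul_isH1Zero (O : Oversampling T C₀) (hD : IsOpen D) (i : Fin nv) {v : Pt d → ℝ}
    {Dv : Pt d → Pt d} (hv : IsH1Vanishing D (O.reg i) v Dv) :
    IsH1Zero D (fun x => O.χ i x * v x)
      (fun x => O.χ i x • Dv x + v x • gradient (O.χ i) x) := by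
  obtain ⟨K, hK⟩ := O.χ_lipschitz i
  have hz : ∀ x ∈ D, x ∉ O.reg i → O.χ i x = 0 := fun x hx hx' =>
    O.χ_support i x hx fun h => hx' (O.nbhd_subset i h)
  refine IsH1Vanishing.extend hD.measurableSet (O.reg_open i).measurableSet
    (hv.mul_lipschitz (O.reg_open i) (O.reg_subset i) hK (O.χ_nonneg i) (O.χ_le_one i) hz)
    (O.reg_subset i) (fun x hx hx' => ?_) fun x hx hx' => ?_
  · rw [hz x hx hx', zero_mul]
  · rw [O.gradient_χ_eq_zero (hz x hx hx'), hz x hx hx', zero_smul, smul_zero, add_zero]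

/-- This is the test function of Caccioppoli's inequality. The square leaves one factor `χ_i⁺` in
its gradient, by which the cross term is absorbed into the weighted energy. -/
theorem χp_sq_mul_isH1Zero (O : Oversampling T C₀) (i : Fin nv) {v : Pt d → ℝ}
    {Dv : Pt d → Pt d} (hv : IsH1Vanishing D (O.reg i) v Dv) :
    IsH1Zero (O.reg i) (fun x => O.χp i x * O.χp i x * v x)
      (fun x => (O.χp i x * O.χp i x) • Dv x + v x • (2 * O.χp i x) • gradient (O.χp i) x) := by
  obtain ⟨K, hK⟩ := O.χp_lipschitz i
  have habs : ∀ x, |O.χp i x| ≤ 1 := fun x => by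
    rw [abs_of_nonneg (O.χp_nonneg i x)]; exact O.χp_le_one i x
  obtain ⟨L, hL⟩ := lipschitzWith_mul hK hK habs fun x _ => habs x
  have key := hv.mul_lipschitz (O.reg_open i) (O.reg_subset i) hL
    (fun x => mul_nonneg (O.χp_nonneg i x) (O.χp_nonneg i x))
    (fun x _ => mul_le_one₀ (O.χp_le_one i x) (O.χp_nonneg i x) (O.χp_le_one i x))
    (fun x hx hx' => by rw [O.χp_support i x hx hx', zero_mul])
  refine IsH1Vanishing.congr_ae key (Eventually.of_forall fun _ => rfl) (ae_restrict_of_ae ?_)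
  filter_upwards [hK.ae_differentiableAt (μ := volume)] with x hx
  rw [gradient_mul hx hx, ← add_smul, two_mul]

end Oversampling

/-! ### Estimates on one oversampled region -/

section Local

variable {d : ℕ} {D : Set (Pt d)} {H : ℝ} {nv ne : ℕ} {T : CoarseGrid D H nv ne} {C₀ : ℝ}
  {O : Oversampling T C₀} {P : EllipticProblem D} {S : SpectralFamily O P.κ}

/-- The local projection error `u - I_i u`. -/
def localError (P : EllipticProblem D) (S : SpectralFamily O P.κ) (i : Fin nv) (x : Pt d) : ℝ :=
  P.u x - P.G x - (S i).comb ((S i).coeff fun y => P.u y - P.G y) x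

/-- The gradient of the local projection error. -/
def localErrorGrad (P : EllipticProblem D) (S : SpectralFamily O P.κ) (i : Fin nv) (x : Pt d) :
    Pt d :=
  P.Du x - P.DG x - (S i).combGrad ((S i).coeff fun y => P.u y - P.G y) x

theorem localError_isH1Vanishing (P : EllipticProblem D) (S : SpectralFamily O P.κ) (i : Fin nv) :
    IsH1Vanishing D (O.reg i) (localError P S i) (localErrorGrad P S i) :=
  (P.u_boundary.mono_right (O.reg_subset i)).sub ((S i).comb_isH1Vanishing _)

/-- Weighted energy of the local error. -/
def cutoffEnergy (P : EllipticProblem D) (S : SpectralFamily O P.κ) (i : Fin nv) : ℝ :=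
  ∫ x in O.reg i, P.κ x * O.χp i x ^ 2 * ‖localErrorGrad P S i x‖ ^ 2

/-- Weighted `L²` norm of the local error. -/
def cutoffMass (P : EllipticProblem D) (S : SpectralFamily O P.κ) (i : Fin nv) : ℝ :=
  ∫ x in O.reg i, P.κ x * ‖gradient (O.χp i) x‖ ^ 2 * localError P S i x ^ 2

theorem ae_reg_mem (O : Oversampling T C₀) (i : Fin nv) :
    ∀ᵐ x ∂volume.restrict (O.reg i), x ∈ O.reg i ∧ x ∈ D := by
  filter_upwards [ae_restrict_mem (O.reg_open i).measurableSet] with x hx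
    using ⟨hx, O.reg_subset i hx⟩

theorem integrable_cutoffEnergy (i : Fin nv) :
    Integrable (fun x => P.κ x * O.χp i x ^ 2 * ‖localErrorGrad P S i x‖ ^ 2)
      (volume.restrict (O.reg i)) := by
  obtain ⟨B, hB⟩ := P.exists_bounds
  obtain ⟨K, hK⟩ := O.χp_lipschitz i
  refine integrable_weight_norm_sq (B := B)
    (P.κ_meas.mul (hK.continuous.measurable.pow_const 2)).aestronglyMeasurable ?_
    (localError_isH1Vanishing P S i).memLp_grad
  filter_upwards [ae_reg_mem O i] with x hx
  have h1 := (hB x hx.2).2.1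
  rw [norm_mul, norm_pow, Real.norm_of_nonneg (O.χp_nonneg i x)]
  exact (mul_le_of_le_one_right (norm_nonneg _)
    (pow_le_one₀ (O.χp_nonneg i x) (O.χp_le_one i x))).trans h1

theorem integrable_cutoffMass (i : Fin nv) :
    Integrable (fun x => P.κ x * ‖gradient (O.χp i) x‖ ^ 2 * localError P S i x ^ 2)
      (volume.restrict (O.reg i)) := by
  obtain ⟨B, hB⟩ := P.exists_bounds
  obtain ⟨K, hK⟩ := O.χp_lipschitz i
  refine integrable_weight_sq (B := B * (K : ℝ) ^ 2)
    (P.κ_meas.mul ((measurable_gradient (O.χp i)).norm.pow_const 2)).aestronglyMeasurable ?_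
    (localError_isH1Vanishing P S i).memLp
  filter_upwards [ae_reg_mem O i] with x hx
  have h1 := (hB x hx.2).2.1
  have h2 := norm_gradient_le hK x
  have := (norm_nonneg _).trans h1
  rw [norm_mul, norm_pow, norm_norm]
  gcongr

theorem cutoffMass_nonneg (i : Fin nv) : 0 ≤ cutoffMass P S i := by
  obtain ⟨B, hB⟩ := P.exists_bounds
  refine integral_nonneg_of_ae ?_
  filter_upwards [ae_reg_mem O i] with x hx
  have := (hB x hx.2).1
  simp only [Pi.zero_apply]
  positivity

theorem cutoffEnergy_nonneg (i : Fin nv) : 0 ≤ cutoffEnergy P S i := by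
  obtain ⟨B, hB⟩ := P.exists_bounds
  refine integral_nonneg_of_ae ?_
  filter_upwards [ae_reg_mem O i] with x hx
  have := (hB x hx.2).1
  simp only [Pi.zero_apply]
  positivity

/-- The oversampled spectral problem controls the mass of the local error by its energy. -/
theorem mul_cutoffMass_le (hD : IsOpen D) {K Λ : ℝ} (hK : C₀ ≤ K)
    (hS : InSnapshots S fun x => P.u x - P.G x) (i : Fin nv) (hΛ0 : 0 ≤ Λ)
    (hΛ : ∀ k : Fin (S i).M, (S i).L ≤ (k : ℕ) → Λ ≤ (S i).lam k) :
    Λ * cutoffMass P S i ≤ K ^ 2 * cutoffEnergy P S i := by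
  obtain ⟨B, hB⟩ := P.exists_bounds
  obtain ⟨B', hB'⟩ := O.exists_massWeight_bound (κ := P.κ) fun x hx => (hB x hx).2.1
  obtain ⟨a, ha⟩ := hS i
  have hωm := T.measurableSet_nbhd hD.measurableSet i
  have hmono := Measure.restrict_mono (O.nbhd_subset i) (le_refl (volume : Measure (Pt d)))
  -- The snapshot hypothesis concerns values only; the gradients agree by uniqueness of weak
  -- gradients.
  have hgrad : ∀ᵐ x ∂volume.restrict (O.reg i), P.Du x - P.DG x = ∑ j, a j • (S i).Dψ j x :=
    IsH1.grad_ae_eq (O.reg_open i) (P.u_boundary.mono_right (O.reg_subset i)).isH1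
      (IsH1Vanishing.linearComb (S i).ψ_h1 a).isH1 ha
  have hκt : ∀ᵐ x ∂volume.restrict (O.reg i), ‖massWeight O P.κ x‖ ≤ B' := by
    filter_upwards [ae_reg_mem O i] with x hx using hB' x hx.2
  have hκ : ∀ᵐ x ∂volume.restrict (T.nbhd i), ‖P.κ x‖ ≤ B := by
    filter_upwards [ae_mono hmono (ae_reg_mem O i)] with x hx using (hB x hx.2).2.1
  have hmeas : AEStronglyMeasurable (massWeight O P.κ) (volume.restrict (O.reg i)) :=
    (O.measurable_massWeight P.κ_meas).aestronglyMeasurable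
  obtain ⟨b, hb1, hb2, hb3⟩ := (S i).projection_error
    (fun m n => integrable_weight_mul hmeas hκt ((S i).ψ_h1 m).memLp ((S i).ψ_h1 n).memLp)
    (fun m n => integrable_weight_inner P.κ_meas.aestronglyMeasurable hκ
      (((S i).ψ_h1 m).memLp_grad.mono_measure hmono)
      (((S i).ψ_h1 n).memLp_grad.mono_measure hmono)) ha hΛ
  have he : ∀ᵐ x ∂volume.restrict (O.reg i), localError P S i x = ∑ j, b j * (S i).ψ j x := by
    filter_upwards [ha] with x hx
    rw [localError, ← hb1, hx]
  have hDe : ∀ᵐ x ∂volume.restrict (O.reg i),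
      localErrorGrad P S i x = ∑ j, b j • (S i).Dψ j x := by
    filter_upwards [hgrad] with x hx
    rw [localErrorGrad, ← hb2, hx]
  have s1 : cutoffMass P S i ≤
      ∫ x in O.reg i, massWeight O P.κ x * (∑ j, b j * (S i).ψ j x) ^ 2 := by
    refine integral_mono_ae (integrable_cutoffMass i) ?_ ?_
    · refine (integrable_weight_sq hmeas hκt (localError_isH1Vanishing P S i).memLp).congr ?_
      filter_upwards [he] with x hx
      rw [hx]
    · filter_upwards [he, ae_reg_mem O i] with x hx hxr
      rw [← hx]
      exact mul_le_mul_of_nonneg_right (O.le_massWeight (hB x hxr.2).1.le i) (sq_nonneg _)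
  have s2 : ∫ x in T.nbhd i, P.κ x * ‖∑ j, b j • (S i).Dψ j x‖ ^ 2 ≤
      ∫ x in T.nbhd i, K ^ 2 * (P.κ x * O.χp i x ^ 2 * ‖localErrorGrad P S i x‖ ^ 2) := by
    refine integral_mono_ae ?_
      (((integrable_cutoffEnergy i).mono_measure hmono).const_mul (K ^ 2)) ?_
    · refine (integrable_weight_norm_sq P.κ_meas.aestronglyMeasurable hκ
        ((localError_isH1Vanishing P S i).memLp_grad.mono_measure hmono)).congr ?_
      filter_upwards [ae_mono hmono hDe] with x hx
      rw [hx]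
    · filter_upwards [ae_mono hmono hDe, ae_restrict_mem hωm] with x hx hxω
      rw [← hx]
      have h0 := (hB x hxω.1).1
      have h1 : 1 ≤ K * O.χp i x := (O.χp_lower i x hxω).trans
        (mul_le_mul_of_nonneg_right hK (O.χp_nonneg i x))
      have h2 : 1 ≤ (K * O.χp i x) ^ 2 := one_le_pow₀ h1
      have h3 : 0 ≤ P.κ x * ‖localErrorGrad P S i x‖ ^ 2 := by positivity
      nlinarith [mul_le_mul_of_nonneg_left h2 h3]
  have s3 : ∫ x in T.nbhd i, P.κ x * O.χp i x ^ 2 * ‖localErrorGrad P S i x‖ ^ 2 ≤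
      cutoffEnergy P S i := by
    refine integral_mono_measure hmono ?_ (integrable_cutoffEnergy i)
    filter_upwards [ae_reg_mem O i] with x hx
    have := (hB x hx.2).1
    simp only [Pi.zero_apply]
    positivity
  calc Λ * cutoffMass P S i ≤ _ := mul_le_mul_of_nonneg_left s1 hΛ0
    _ ≤ _ := hb3
    _ ≤ _ := s2
    _ ≤ _ := by
      rw [integral_const_mul]
      exact mul_le_mul_of_nonneg_left s3 (sq_nonneg K)

/-- Caccioppoli's inequality for the residual equation with cutoff `χ_i⁺`. The lower gradient bound
`grad_lower` supplies `c = K H²`; the parameter `s` is left free to balance the two terms. -/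
theorem cutoffEnergy_le {K s : ℝ} (hK : C₀ ≤ K) (hs : 0 < s) {i : Fin nv} {g : Pt d → ℝ}
    (hg : IsResidual P S i g) :
    cutoffEnergy P S i ≤ s * (∫ x in O.reg i, (P.κ x)⁻¹ * g x ^ 2) +
      (K * H ^ 2 / s + 4) * cutoffMass P S i := by
  obtain ⟨B, hB⟩ := P.exists_bounds
  have hv := O.χp_sq_mul_isH1Zero i (localError_isH1Vanishing P S i)
  have hκ : ∀ᵐ x ∂volume.restrict (O.reg i), ‖P.κ x‖ ≤ B := by
    filter_upwards [ae_reg_mem O i] with x hx using (hB x hx.2).2.1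
  have hκi : ∀ᵐ x ∂volume.restrict (O.reg i), ‖(P.κ x)⁻¹‖ ≤ B := by
    filter_upwards [ae_reg_mem O i] with x hx using (hB x hx.2).2.2
  unfold cutoffEnergy cutoffMass
  refine caccioppoli (c := K * H ^ 2) hs ?_ (O.χp_nonneg i) (O.χp_le_one i) ?_ (integrable_cutoffEnergy i)
    (integrable_weight_sq P.κ_meas.inv.aestronglyMeasurable hκi hg.memLp)
    (integrable_cutoffMass i)
    (integrable_weight_inner P.κ_meas.aestronglyMeasurable hκ
      (localError_isH1Vanishing P S i).memLp_grad hv.memLp_grad)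
    (hg.memLp.integrable_mul hv.memLp) ?_
  · filter_upwards [ae_reg_mem O i] with x hx using (hB x hx.2).1
  · filter_upwards [O.grad_lower i] with x hx
    rw [norm_gradient]
    refine hx.trans ?_
    gcongr
  · rw [← hg.weak _ _ hv]
    simp only [localErrorGrad, sub_sub]

/-- On `ω_i` the function `χ_i` and its gradient are dominated by those of `χ_i⁺`, and off `ω_i` the
integrand vanishes. -/
theorem integral_partition_error_le (hD : IsOpen D) {K : ℝ} (hK : C₀ ≤ K) (hK1 : 1 ≤ K)
    (i : Fin nv) :
    ∫ x in O.reg i, P.κ x * ‖O.χ i x • localErrorGrad P S i x +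
        localError P S i x • gradient (O.χ i) x‖ ^ 2 ≤
      2 * K ^ 2 * cutoffEnergy P S i + 2 * K * cutoffMass P S i := by
  obtain ⟨B, hB⟩ := P.exists_bounds
  have hmono := Measure.restrict_mono (O.reg_subset i) (le_refl (volume : Measure (Pt d)))
  have hωm := T.measurableSet_nbhd hD.measurableSet i
  have hκ : ∀ᵐ x ∂volume.restrict (O.reg i), ‖P.κ x‖ ≤ B := by
    filter_upwards [ae_reg_mem O i] with x hx using (hB x hx.2).2.1
  have hgl : ∀ᵐ x ∂volume.restrict (O.reg i), x ∈ T.nbhd i →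
      ‖fderiv ℝ (O.χ i) x‖ ^ 2 ≤ C₀ * ‖fderiv ℝ (O.χp i) x‖ ^ 2 :=
    ae_restrict_of_ae ((ae_restrict_iff' hωm).1 (O.grad_le i))
  have hle : ∫ x in O.reg i, P.κ x * ‖O.χ i x • localErrorGrad P S i x +
        localError P S i x • gradient (O.χ i) x‖ ^ 2 ≤
      ∫ x in O.reg i, 2 * K ^ 2 * (P.κ x * O.χp i x ^ 2 * ‖localErrorGrad P S i x‖ ^ 2) +
        2 * K * (P.κ x * ‖gradient (O.χp i) x‖ ^ 2 * localError P S i x ^ 2) := by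
    refine integral_mono_ae (integrable_weight_norm_sq P.κ_meas.aestronglyMeasurable hκ
      ((O.χ_mul_isH1Zero hD i (localError_isH1Vanishing P S i)).memLp_grad.mono_measure hmono))
      (((integrable_cutoffEnergy i).const_mul _).add ((integrable_cutoffMass i).const_mul _)) ?_
    filter_upwards [hgl, ae_reg_mem O i] with x hx hxr
    have h0 := (hB x hxr.2).1
    by_cases hxω : x ∈ T.nbhd i
    · have h1 : O.χ i x ≤ K * O.χp i x := (O.χ_le_one i x hxr.2).trans ((O.χp_lower i x hxω).trans
        (mul_le_mul_of_nonneg_right hK (O.χp_nonneg i x)))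
      have h2 : ‖gradient (O.χ i) x‖ ^ 2 ≤ K * ‖gradient (O.χp i) x‖ ^ 2 := by
        rw [norm_gradient, norm_gradient]
        exact (hx hxω).trans (mul_le_mul_of_nonneg_right hK (sq_nonneg _))
      have h3 : O.χ i x ^ 2 ≤ (K * O.χp i x) ^ 2 := pow_le_pow_left₀ (O.χ_nonneg i x) h1 2
      have h4 : ‖O.χ i x • localErrorGrad P S i x + localError P S i x • gradient (O.χ i) x‖ ^ 2 ≤
          2 * (O.χ i x ^ 2 * ‖localErrorGrad P S i x‖ ^ 2) +
          2 * (localError P S i x ^ 2 * ‖gradient (O.χ i) x‖ ^ 2) := by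
        have := norm_add_le (O.χ i x • localErrorGrad P S i x)
          (localError P S i x • gradient (O.χ i) x)
        rw [norm_smul, norm_smul, Real.norm_eq_abs, Real.norm_eq_abs] at this
        have h5 := pow_le_pow_left₀ (norm_nonneg _) this 2
        rw [← sq_abs (O.χ i x), ← sq_abs (localError P S i x)]
        nlinarith [sq_nonneg (|O.χ i x| * ‖localErrorGrad P S i x‖ -
          |localError P S i x| * ‖gradient (O.χ i) x‖)]
      calc P.κ x * ‖O.χ i x • localErrorGrad P S i x +
            localError P S i x • gradient (O.χ i) x‖ ^ 2
          ≤ P.κ x * (2 * ((K * O.χp i x) ^ 2 * ‖localErrorGrad P S i x‖ ^ 2) +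
            2 * (localError P S i x ^ 2 * (K * ‖gradient (O.χp i) x‖ ^ 2))) := by
            refine mul_le_mul_of_nonneg_left (h4.trans ?_) h0.le
            gcongr
        _ = _ := by ring
    · have hz := O.χ_support i x hxr.2 hxω
      rw [O.gradient_χ_eq_zero hz, hz, zero_smul, smul_zero, add_zero, norm_zero,
        zero_pow two_ne_zero, mul_zero]
      have : 0 ≤ K := by linarith
      positivity
  refine hle.trans (le_of_eq ?_)
  rw [integral_add ((integrable_cutoffEnergy i).const_mul _)
    ((integrable_cutoffMass i).const_mul _), integral_const_mul, integral_const_mul]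
  rfl

/-- Mass bounds energy and energy bounds mass; a large `Λ` breaks the circle and leaves only the
residual. -/
theorem integral_partition_error_le_residual (hD : IsOpen D) (hH : 0 < H) {K Λ : ℝ} (hK : C₀ ≤ K)
    (hK1 : 1 ≤ K) (hΛK : 16 * K ^ 2 ≤ Λ) (hS : InSnapshots S fun x => P.u x - P.G x) {i : Fin nv}
    (hΛ : ∀ k : Fin (S i).M, (S i).L ≤ (k : ℕ) → Λ ≤ (S i).lam k) {g : Pt d → ℝ}
    (hg : IsResidual P S i g) :
    ∫ x in O.reg i, P.κ x * ‖O.χ i x • localErrorGrad P S i x +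
        localError P S i x • gradient (O.χ i) x‖ ^ 2 ≤
      32 * K ^ 5 * H ^ 2 / Λ * ∫ x in O.reg i, (P.κ x)⁻¹ * g x ^ 2 := by
  have hΛ0 : 0 < Λ := by nlinarith
  have hK0 : 0 < K := by linarith
  have h1 := mul_cutoffMass_le hD hK hS i hΛ0.le hΛ
  -- This `s` makes `K H²/s = Λ/(4K²)`, so by the spectral bound that term costs `Y/4`. With `Λ ≥
  -- 16K²` the remaining `4X` costs another `Y/4`, and half of `Y` survives.
  have h2 := cutoffEnergy_le hK (s := 4 * K ^ 3 * H ^ 2 / Λ) (by positivity) hg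
  have h3 := integral_partition_error_le (P := P) (S := S) hD hK hK1 i
  have hX := cutoffMass_nonneg (P := P) (S := S) i
  have hY := cutoffEnergy_nonneg (P := P) (S := S) i
  set X := cutoffMass P S i
  set Y := cutoffEnergy P S i
  set G := ∫ x in O.reg i, (P.κ x)⁻¹ * g x ^ 2
  have e1 : K * H ^ 2 / (4 * K ^ 3 * H ^ 2 / Λ) * X ≤ 1 / 4 * Y := by
    have : K * H ^ 2 / (4 * K ^ 3 * H ^ 2 / Λ) * X = 1 / (4 * K ^ 2) * (Λ * X) := by
      field_simp
    rw [this]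
    calc 1 / (4 * K ^ 2) * (Λ * X) ≤ 1 / (4 * K ^ 2) * (K ^ 2 * Y) :=
          mul_le_mul_of_nonneg_left h1 (by positivity)
      _ = 1 / 4 * Y := by field_simp
  have e2 : 16 * X ≤ Y := by
    have : K ^ 2 * (16 * X) ≤ K ^ 2 * Y := by nlinarith
    exact le_of_mul_le_mul_left this (by positivity)
  have e3 : Y ≤ 8 * K ^ 3 * H ^ 2 / Λ * G := by
    have : 8 * K ^ 3 * H ^ 2 / Λ * G = 2 * (4 * K ^ 3 * H ^ 2 / Λ * G) := by ring
    rw [add_mul] at h2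
    rw [this]
    linarith
  calc _ ≤ 2 * K ^ 2 * Y + 2 * K * X := h3
    _ ≤ 4 * K ^ 2 * Y := by nlinarith [mul_nonneg hK0.le hX, mul_nonneg hK0.le hY]
    _ ≤ 4 * K ^ 2 * (8 * K ^ 3 * H ^ 2 / Λ * G) := by gcongr
    _ = _ := by ring

end Local

/-! ### The global estimate -/

section Global

variable {d : ℕ} {D : Set (Pt d)} {H : ℝ} {nv ne : ℕ} {T : CoarseGrid D H nv ne} {C₀ : ℝ}
  {O : Oversampling T C₀}

/-- The gradient of `∑ χ_i comb_i`. -/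
def offlineGrad {κ : Pt d → ℝ} (S : SpectralFamily O κ) (c : (i : Fin nv) → Fin (S i).M → ℝ)
    (x : Pt d) : Pt d :=
  ∑ i, (O.χ i x • (S i).combGrad (c i) x + (S i).comb (c i) x • gradient (O.χ i) x)

theorem offline_isH1Zero (hD : IsOpen D) {κ : Pt d → ℝ} (S : SpectralFamily O κ)
    (c : (i : Fin nv) → Fin (S i).M → ℝ) :
    IsH1Zero D (fun x => ∑ i, O.χ i x * (S i).comb (c i) x) (offlineGrad S c) :=
  IsH1Vanishing.sum _ fun i _ => O.χ_mul_isH1Zero hD i ((S i).comb_isH1Vanishing (c i))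

variable {P : EllipticProblem D} {S : SpectralFamily O P.κ}

/-- The Galerkin solution is at least as accurate as the interpolation
`G + ∑ χ_i P_i (u - G)`. -/
theorem galerkin_error_le (hD : IsOpen D) {uH : Pt d → ℝ} {DuH : Pt d → Pt d}
    (hu : IsGalerkin P S uH DuH) (c₀ : (i : Fin nv) → Fin (S i).M → ℝ) :
    ∫ x in D, P.κ x * ‖P.Du x - DuH x‖ ^ 2 ≤
      ∫ x in D, P.κ x * ‖P.Du x - P.DG x - offlineGrad S c₀ x‖ ^ 2 := by
  obtain ⟨B, hB⟩ := P.exists_bounds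
  have hκ : ∀ᵐ x ∂volume.restrict D, ‖P.κ x‖ ≤ B := by
    filter_upwards [ae_restrict_mem hD.measurableSet] with x hx using (hB x hx).2.1
  have hκm : AEStronglyMeasurable P.κ (volume.restrict D) := P.κ_meas.aestronglyMeasurable
  obtain ⟨c, hc⟩ := hu.offline
  -- `DuH` is known only as a weak gradient; uniqueness identifies it with the explicit product-rule
  -- gradient of the offline function.
  have hgrad : ∀ᵐ x ∂volume.restrict D, DuH x - P.DG x = offlineGrad S c x := by
    refine IsH1.grad_ae_eq hD (hu.h1.sub P.G_h1) (offline_isH1Zero hD S c).isH1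
      (Eventually.of_forall fun x => ?_)
    exact congrFun hc x
  have hE : MemLp (fun x => P.Du x - DuH x) 2 (volume.restrict D) :=
    P.u_h1.memLp_grad.sub hu.h1.memLp_grad
  have hoff := fun c => (offline_isH1Zero hD S c).memLp_grad
  have hF := (P.u_h1.memLp_grad.sub P.G_h1.memLp_grad).sub (hoff c₀)
  have horth : ∀ c', ∫ x in D, P.κ x * ⟪P.Du x - DuH x, offlineGrad S c' x⟫_ℝ = 0 := by
    intro c'
    have h1 := hu.galerkin _ _ ⟨c', rfl⟩ (offline_isH1Zero hD S c')
    have h2 := P.u_weak _ _ (offline_isH1Zero hD S c')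
    have e := integral_sub (integrable_weight_inner hκm hκ P.u_h1.memLp_grad (hoff c'))
      (integrable_weight_inner hκm hκ hu.h1.memLp_grad (hoff c'))
    simp only [inner_sub_left, mul_sub]
    rw [e, h1, h2, sub_self]
  have hdiff : ∀ᵐ x ∂volume.restrict D, P.κ x * ⟪P.Du x - DuH x,
      P.Du x - DuH x - (P.Du x - P.DG x - offlineGrad S c₀ x)⟫_ℝ =
      P.κ x * ⟪P.Du x - DuH x, offlineGrad S c₀ x⟫_ℝ -
        P.κ x * ⟪P.Du x - DuH x, offlineGrad S c x⟫_ℝ := by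
    filter_upwards [hgrad] with x hx
    rw [← mul_sub, ← inner_sub_right, ← hx]
    congr 2
    abel
  refine energy_le_of_orthogonal ?_ (integrable_weight_norm_sq hκm hκ hE)
    (integrable_weight_norm_sq hκm hκ hF) (integrable_weight_inner hκm hκ hE (hE.sub hF)) ?_
  · filter_upwards [ae_restrict_mem hD.measurableSet] with x hx using (hB x hx).1.le
  · rw [integral_congr_ae hdiff, integral_sub (integrable_weight_inner hκm hκ hE (hoff c₀))
      (integrable_weight_inner hκm hκ hE (hoff c)), horth, horth, sub_self]

/-- Insert `∑ χ_i = 1` in front of `∇(u - G)` and add `(u - G) ∑ ∇χ_i = 0`. -/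
theorem interpolation_error_eq (hD : IsOpen D) (P : EllipticProblem D)
    (S : SpectralFamily O P.κ) : ∀ᵐ x ∂volume.restrict D,
    P.Du x - P.DG x - offlineGrad S (fun i => (S i).coeff fun y => P.u y - P.G y) x =
      ∑ i, (O.χ i x • localErrorGrad P S i x + localError P S i x • gradient (O.χ i) x) := by
  filter_upwards [O.sum_gradient_χ hD, ae_restrict_mem hD.measurableSet] with x hx hxD
  have h1 : ∑ i, O.χ i x • (P.Du x - P.DG x) = P.Du x - P.DG x := by
    rw [← Finset.sum_smul, O.χ_sum x hxD, one_smul]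
  have h2 : ∑ i, (P.u x - P.G x) • gradient (O.χ i) x = 0 := by
    rw [← Finset.smul_sum, hx, smul_zero]
  simp only [localError, localErrorGrad, offlineGrad, smul_sub, sub_smul, Finset.sum_add_distrib,
    Finset.sum_sub_distrib] at h1 h2 ⊢
  rw [h1, h2]
  abel

/-- Cauchy–Schwarz over the nonzero terms only, so that the constant is the overlap and not the
number of nodes. -/
theorem norm_sum_sq_le {ι E : Type*} [Fintype ι] [SeminormedAddCommGroup E] {t : ι → E}
    {s : Set ι} (ht : ∀ i, i ∉ s → t i = 0) {K : ℝ} (hs : (s.ncard : ℝ) ≤ K) :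
    ‖∑ i, t i‖ ^ 2 ≤ K * ∑ i, ‖t i‖ ^ 2 := by
  classical
  have h1 : ∑ i, t i = ∑ i ∈ s.toFinset, t i :=
    (Finset.sum_subset (Finset.subset_univ _) fun i _ hi => ht i (by simpa using hi)).symm
  calc ‖∑ i, t i‖ ^ 2 ≤ (∑ i ∈ s.toFinset, ‖t i‖) ^ 2 := by
        rw [h1]
        exact pow_le_pow_left₀ (norm_nonneg _) (norm_sum_le _ _) 2
    _ ≤ (s.toFinset.card : ℝ) * ∑ i ∈ s.toFinset, ‖t i‖ ^ 2 := sq_sum_le_card_mul_sum_sq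
    _ ≤ K * ∑ i, ‖t i‖ ^ 2 := by
        rw [← Set.ncard_eq_toFinset_card']
        refine mul_le_mul hs ?_ (Finset.sum_nonneg fun _ _ => sq_nonneg _)
          ((Nat.cast_nonneg _).trans hs)
        exact Finset.sum_le_sum_of_subset_of_nonneg (Finset.subset_univ _)
          fun _ _ _ => sq_nonneg _

theorem galerkin_error_le_sum (hD : IsOpen D) {K : ℝ} (hK : C₀ ≤ K) {uH : Pt d → ℝ}
    {DuH : Pt d → Pt d} (hu : IsGalerkin P S uH DuH) :
    ∫ x in D, P.κ x * ‖P.Du x - DuH x‖ ^ 2 ≤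
      K * ∑ i, ∫ x in O.reg i, P.κ x * ‖O.χ i x • localErrorGrad P S i x +
        localError P S i x • gradient (O.χ i) x‖ ^ 2 := by
  obtain ⟨B, hB⟩ := P.exists_bounds
  have hκ : ∀ᵐ x ∂volume.restrict D, ‖P.κ x‖ ≤ B := by
    filter_upwards [ae_restrict_mem hD.measurableSet] with x hx using (hB x hx).2.1
  let t : Fin nv → Pt d → Pt d := fun i x =>
    O.χ i x • localErrorGrad P S i x + localError P S i x • gradient (O.χ i) x
  have ht0 : ∀ i, ∀ x ∈ D, x ∉ O.reg i → t i x = 0 := fun i x hx hx' => by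
    have hz := O.χ_support i x hx fun h => hx' (O.nbhd_subset i h)
    simp only [t]
    rw [O.gradient_χ_eq_zero hz, hz, zero_smul, smul_zero, add_zero]
  have ht : ∀ i, MemLp (t i) 2 (volume.restrict D) := fun i =>
    (O.χ_mul_isH1Zero hD i (localError_isH1Vanishing P S i)).memLp_grad
  have hi : ∀ i, Integrable (fun x => P.κ x * ‖t i x‖ ^ 2) (volume.restrict D) := fun i =>
    integrable_weight_norm_sq P.κ_meas.aestronglyMeasurable hκ (ht i)
  refine (galerkin_error_le hD hu fun i => (S i).coeff fun y => P.u y - P.G y).trans ?_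
  calc ∫ x in D, P.κ x * ‖P.Du x - P.DG x -
          offlineGrad S (fun i => (S i).coeff fun y => P.u y - P.G y) x‖ ^ 2
      = ∫ x in D, P.κ x * ‖∑ i, t i x‖ ^ 2 := by
        refine integral_congr_ae ?_
        filter_upwards [interpolation_error_eq hD P S] with x hx
        rw [hx]
    _ ≤ ∫ x in D, K * ∑ i, P.κ x * ‖t i x‖ ^ 2 := by
        refine integral_mono_ae (integrable_weight_norm_sq P.κ_meas.aestronglyMeasurable hκ
          (memLp_finsetSum _ fun i _ => ht i))
          ((integrable_finsetSum _ fun i _ => hi i).const_mul K) ?_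
        filter_upwards [ae_restrict_mem hD.measurableSet] with x hx
        have h1 := norm_sum_sq_le (t := fun i => t i x) (s := {i | x ∈ O.reg i})
          (fun i hi => ht0 i x hx hi) ((O.overlap x hx).trans hK)
        have h2 := mul_le_mul_of_nonneg_left h1 (hB x hx).1.le
        rw [← Finset.mul_sum]
        linarith
    _ = K * ∑ i, ∫ x in O.reg i, P.κ x * ‖t i x‖ ^ 2 := by
        rw [integral_const_mul, integral_finsetSum _ fun i _ => hi i]
        congr 1
        refine Finset.sum_congr rfl fun i _ => ?_
        refine setIntegral_eq_of_subset_of_forall_sdiff_eq_zero hD.measurableSet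
          (O.reg_subset i) fun x hx => ?_
        rw [ht0 i x hx.1 hx.2, norm_zero]
        ring

end Global

end GMsFEM

end

/-! ### The main theorem and its constants. -/

theorem mainTheorem1 (d : ℕ) (C₀ : ℝ) :
    ∃ Λ₀ : ℝ, 1 ≤ Λ₀ ∧ ∀ Cg : ℝ, ∃ C : ℝ, 0 < C ∧
      ∀ (D : Set (GMsFEM.Pt d)), IsOpen D →
      ∀ (H : ℝ), 0 < H → H ≤ 1 →
      ∀ (nv ne : ℕ) (T : GMsFEM.CoarseGrid D H nv ne) (O : GMsFEM.Oversampling T C₀)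
        (P : GMsFEM.EllipticProblem D) (S : GMsFEM.SpectralFamily O P.κ),
      GMsFEM.InSnapshots S (fun x => P.u x - P.G x) →
      ∀ (Λ : ℝ), IsLeast S.excluded Λ → Λ₀ ≤ Λ →
      ∀ (g : Fin nv → GMsFEM.Pt d → ℝ), (∀ i, GMsFEM.IsResidual P S i (g i)) →
      (∑ i, ∫ x in O.reg i, (P.κ x)⁻¹ * g i x ^ 2) ≤ Cg →
      ∀ (uH : GMsFEM.Pt d → ℝ) (DuH : GMsFEM.Pt d → GMsFEM.Pt d),
        GMsFEM.IsGalerkin P S uH DuH →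
        (∫ x in D, P.κ x * ‖P.Du x - DuH x‖ ^ 2) ≤
          C * (H / Λ * (∫ x in D, P.κ x * ‖P.Du x‖ ^ 2) + H / Λ) := by
  -- `C₀` is an arbitrary real number; the maximum provides the bound `1 ≤ K` used in the local
  -- estimates.
  set K : ℝ := max C₀ 1
  have hK : C₀ ≤ K := le_max_left _ _
  have hK1 : 1 ≤ K := le_max_right _ _
  have hK0 : 0 < K := by linarith
  -- `16 K²` is the absorption threshold. In `C`, one factor `K` is the overlap and `K⁵` is local;
  -- `|Cg| + 1`-type padding keeps `C` positive for every real `Cg`.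
  refine ⟨16 * K ^ 2, by nlinarith, fun Cg => ⟨32 * K ^ 6 * |Cg| + 1, by positivity, ?_⟩⟩
  intro D hD H hH hH1 nv ne T O P S hS Λ hΛ hΛK g hg hCg uH DuH hu
  have hΛ0 : 0 < Λ := lt_of_lt_of_le (by positivity) hΛK
  have hE : 0 ≤ ∫ x in D, P.κ x * ‖P.Du x‖ ^ 2 := by
    obtain ⟨B, hB⟩ := P.exists_bounds
    exact setIntegral_nonneg hD.measurableSet fun x hx =>
      mul_nonneg (hB x hx).1.le (sq_nonneg _)
  have hlam : ∀ i, ∀ k : Fin (S i).M, (S i).L ≤ (k : ℕ) → Λ ≤ (S i).lam k :=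
    fun i k hk => hΛ.2 ⟨i, k, hk, rfl⟩
  calc ∫ x in D, P.κ x * ‖P.Du x - DuH x‖ ^ 2
      ≤ K * ∑ i, 32 * K ^ 5 * H ^ 2 / Λ * ∫ x in O.reg i, (P.κ x)⁻¹ * g i x ^ 2 :=
        (GMsFEM.galerkin_error_le_sum hD hK hu).trans (mul_le_mul_of_nonneg_left
          (Finset.sum_le_sum fun i _ => GMsFEM.integral_partition_error_le_residual hD hH hK hK1
            hΛK hS (hlam i) (hg i)) hK0.le)
    _ = 32 * K ^ 6 * H ^ 2 / Λ * ∑ i, ∫ x in O.reg i, (P.κ x)⁻¹ * g i x ^ 2 := by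
        rw [← Finset.mul_sum]
        ring
    _ ≤ 32 * K ^ 6 * H ^ 2 / Λ * |Cg| :=
        mul_le_mul_of_nonneg_left (hCg.trans (le_abs_self _)) (by positivity)
    _ = 32 * K ^ 6 * |Cg| * (H * H / Λ) := by ring
    -- Here `H ≤ 1` is used to give up one of the two factors `H`.
    _ ≤ 32 * K ^ 6 * |Cg| * (H * 1 / Λ) := by gcongr
    _ ≤ (32 * K ^ 6 * |Cg| + 1) * (H / Λ * (∫ x in D, P.κ x * ‖P.Du x‖ ^ 2) + H / Λ) := by
        rw [mul_one]
        refine mul_le_mul (by linarith) ?_ (by positivity) (by positivity)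
        have : 0 ≤ H / Λ * ∫ x in D, P.κ x * ‖P.Du x‖ ^ 2 := by positivity
        linarith
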